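/- All graphs are finite and simple, and "$G$ contains $H$" means that $G$ has a subgraph (not necessarily induced) isomorphic to $H$. Write $K_m$ for the complete graph on $m$ vertices, $C_m$ for the cycle on $m$ vertices and $P_m$ for the path on $m+1$ vertices ($m$ edges); $K_3\cup P_3$ is a disjoint union. If $H$ is a graph on at most $m$ vertices, $K_m-H$ denotes the graph obtained from $K_m$ by removing the edges of a copy of $H$. Put $Z_4=K_4-P_2$. A non-increasing sequence $\pi=(d_1,\dots,d_n)$ of nonnegative integers is graphic if it is the degree sequence of a graph on $n$ vertices; any such graph is a realization of $\pi$. A graphic sequence is potentially $H$-graphic if some realization of it contains $H$. Let $\sigma(H,n)$ be the least even integer $l$ such that every $n$-term graphic sequence $\pi$ with $d_1+\dots+d_n\ge l$ is potentially $H$-graphic. Theorem 1.2. Let $n\ge 5r+18$, $r+1\ge k\ge 7$ and $j\ge 6$, and let $U$ be a graph on $k$ vertices with $j$ edges that contains $K_3\cup P_3$ but contains neither $C_4$ nor $Z_4$. Then $$\sigma(K_{r+1}-U,n)=\begin{cases}(r-1)(2n-r)-3(n-r)-1, & \text{if } n-r \text{ is odd},\\ (r-1)(2n-r)-3(n-r),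 & \text{if } n-r\text{ is even}.\end{cases}$$ -/

import Mathlib

open scoped SimpleGraph

/-- `K_m - H`: the complete graph on `W` with the edges of a copy of `H`, placed on the
vertices `f v` of `W`, removed. -/
def completeMinus {V W : Type*} (H : SimpleGraph V) (f : V ↪ W) : SimpleGraph W :=
  (H.map f)ᶜ

/-- `G` is a realization of the `n`-term sequence `d`: the vertex `i` has degree `d i`. -/
def IsRealization {n : ℕ} (G : SimpleGraph (Fin n)) (d : Fin n → ℕ) : Prop :=
  ∀ i, (G.neighborSet i).ncard = d i

/-- A non-increasing sequence of `n` nonnegative integers is graphic (lies in `GS_n`) if it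
is the degree sequence of a simple graph on `n` vertices. -/
def IsGraphic {n : ℕ} (d : Fin n → ℕ) : Prop :=
  Antitone d ∧ ∃ G : SimpleGraph (Fin n), IsRealization G d

/-- The sequence `d` has a realization containing `H` as a (not necessarily induced)
subgraph. -/
def PotentiallyGraphic {V : Type*} {n : ℕ} (H : SimpleGraph V) (d : Fin n → ℕ) : Prop :=
  ∃ G : SimpleGraph (Fin n), IsRealization G d ∧ H ⊑ G

/-- The even integers `l` such that every `n`-term graphic sequence with sum at least `l`
is potentially `H`-graphic. -/
def sigmaSet {V : Type*} (H : SimpleGraph V) (n : ℕ) : Set ℕ :=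
  {l | Even l ∧ ∀ d : Fin n → ℕ, IsGraphic d → l ≤ ∑ i, d i → PotentiallyGraphic H d}

/-- `σ(H, n)`: the least even integer `l` such that every `n`-term graphic sequence with sum
at least `l` is potentially `H`-graphic. -/
noncomputable def sigma {V : Type*} (H : SimpleGraph V) (n : ℕ) : ℕ :=
  sInf (sigmaSet H n)

/-- `K_3 ∪ P_3`, the disjoint union of a triangle and a path with 3 edges (4 vertices). -/
def K3unionP3 : SimpleGraph (Fin 3 ⊕ Fin 4) :=
  (⊤ : SimpleGraph (Fin 3)) ⊕g SimpleGraph.pathGraph 4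

/-- `Z_4 = K_4 - P_2`, where `P_2` is the path with 2 edges (3 vertices). -/
def Z4 : SimpleGraph (Fin 4) :=
  completeMinus (SimpleGraph.pathGraph 3) (Fin.castLEEmb (by norm_num))

/-! Lower bound: join m = r - 3 universal vertices to a graph with all degrees 1, except possibly a
single 2 that fixes the parity. In any graph with these degrees, four vertices of a copy of K_{r+1}
- U avoid the universal ones. The graph they induce has a complement containing C_4 or Z_4
(`cycleGraph_isContained_compl_or`), and that complement consists of edges of U, which is
impossible. The degree sum is the claimed value minus 2.

Upper bound: since U contains K_3 ∪ P_3, it is enough to find, with the same degrees, r + 1 vertices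
whose missing edges lie in a copy of K_3 ∪ P_3. This is `exists_isCliqueMinus`, by induction on r.
Let D be the sorted degrees. If at most D 0 + 1 vertices have degree at least D r, a vertex u of
largest degree can be joined to all the others among them (`exists_adj_top`). Deleting u lowers the
sum by at most 2(n - 1), exactly the drop of the threshold from (r, n) to (r - 1, n - 1), and the
near-clique given by induction is moved into the neighbourhood of u by exchanges
(`IsCliqueMinus.exists_subset`).

Otherwise D is constant from D r to D (D 0 + 1), and a realization is built directly
(`exists_vdeg_eq_cliqueWithout`). The first r + 1 vertices form a clique without a few edges, chosen
to relieve the vertices of degree below r; the rest of their degrees is spread evenly over the other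
vertices, whose remaining demands are then nearly constant and hence graphic. The sum bound forces D
r ≥ r - 2 and leaves so few deficient vertices that nothing, an edge, two edges, a triangle with or
without an extra edge, or a path of two or three edges is enough to omit. -/

/-! ### Exchanging neighbours between two vertices. -/

section SwapOn

open scoped Classical

variable {V : Type*} [DecidableEq V]

/-- Exchange the adjacencies of `y` and `z` to the vertices of `S`. -/
def swapOn (G : SimpleGraph V) (y z : V) (S : Finset V) : SimpleGraph V where
  Adj a b := if (b ∈ S ∧ (a = y ∨ a = z)) ∨ (a ∈ S ∧ (b = y ∨ b = z)) then
    G.Adj (Equiv.swap y z a) (Equiv.swap y z b) else G.Adj a b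
  symm := ⟨fun a b h => by
    simp only [G.adj_comm (Equiv.swap y z b), G.adj_comm b, or_comm (a := b ∈ S ∧ _)] at h ⊢
    convert h using 1⟩
  loopless := ⟨fun a h => by
    split_ifs at h
    · exact G.loopless.irrefl _ h
    · exact G.loopless.irrefl _ h⟩

variable {G : SimpleGraph V} {y z : V} {S : Finset V}

theorem swapOn_adj_of_ne {a b : V} (hay : a ≠ y) (haz : a ≠ z) (hby : b ≠ y) (hbz : b ≠ z) :
    (swapOn G y z S).Adj a b ↔ G.Adj a b := by
  simp [swapOn, hay, haz, hby, hbz]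

theorem swapOn_adj_left {w : V} (hy : y ∉ S) (hz : z ∉ S) :
    (swapOn G y z S).Adj y w ↔ if w ∈ S then G.Adj z w else G.Adj y w := by
  by_cases hw : w ∈ S
  · have h1 : w ≠ y := fun h => hy (h ▸ hw)
    have h2 : w ≠ z := fun h => hz (h ▸ hw)
    simp [swapOn, hw, Equiv.swap_apply_of_ne_of_ne h1 h2]
  · simp [swapOn, hw, hy]

theorem swapOn_comm : swapOn G y z S = swapOn G z y S := by
  ext a b
  simp only [swapOn, Equiv.swap_comm y z, or_comm (a := a = y), or_comm (a := b = y)]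

end SwapOn

/-! ### Degree-preserving exchanges: moving near-cliques, Havel–Hakimi. -/

section Degrees

open scoped Classical

variable {V : Type*} [Fintype V]

/-- The degree of a vertex, with the decidability instances chosen classically. -/
noncomputable def vdeg (G : SimpleGraph V) (v : V) : ℕ :=
  (Finset.univ.filter fun w => G.Adj v w).card

theorem ncard_neighborSet_eq_vdeg (G : SimpleGraph V) (v : V) :
    (G.neighborSet v).ncard = vdeg G v := by
  rw [vdeg, ← Set.ncard_coe_finset]
  congr 1
  ext w
  simp

theorem even_sum_vdeg (G : SimpleGraph V) : Even (∑ v, vdeg G v) := by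
  have h := G.sum_degrees_eq_twice_card_edges
  have h2 : ∑ v, vdeg G v = ∑ v, G.degree v := by
    refine Finset.sum_congr rfl fun v _ => ?_
    rw [vdeg, ← SimpleGraph.card_neighborFinset_eq_degree]
    congr 1
    ext w
    simp
  rw [h2, h]
  exact even_two_mul _

theorem vdeg_lt_card (G : SimpleGraph V) (v : V) : vdeg G v < Fintype.card V := by
  rw [vdeg, ← Finset.card_univ]
  refine Finset.card_lt_card (Finset.ssubset_univ_iff.2 fun h => ?_)
  exact G.loopless.irrefl v (Finset.filter_eq_self.1 h v (Finset.mem_univ v))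

theorem vdeg_eq_sum (G : SimpleGraph V) (v : V) :
    vdeg G v = ∑ w, if G.Adj v w then 1 else 0 := by
  rw [vdeg, Finset.card_filter]

theorem vdeg_sup {G H : SimpleGraph V} {v : V} (h : ∀ w, G.Adj v w → ¬ H.Adj v w) :
    vdeg (G ⊔ H) v = vdeg G v + vdeg H v := by
  rw [vdeg, vdeg, vdeg, ← Finset.card_union_of_disjoint]
  · congr 1
    ext w
    simp
  · exact Finset.disjoint_filter.2 fun w _ => h w

theorem vdeg_eq_zero {G : SimpleGraph V} {v : V} : vdeg G v = 0 ↔ ∀ w, ¬ G.Adj v w := by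
  rw [vdeg, Finset.card_eq_zero, Finset.filter_eq_empty_iff]
  simp

theorem vdeg_map_equiv {W : Type*} [Fintype W] (e : V ≃ W) (G : SimpleGraph W) (v : V) :
    vdeg (G.comap e) v = vdeg G (e v) := by
  rw [vdeg, vdeg, ← Finset.card_map e.toEmbedding]
  congr 1
  ext w
  simp only [Finset.mem_map, Finset.mem_filter, Finset.mem_univ, true_and, SimpleGraph.comap_adj,
    Equiv.coe_toEmbedding]
  exact ⟨by rintro ⟨a, h, rfl⟩; exact h, fun h => ⟨e.symm w, by simpa using h, by simp⟩⟩

variable [DecidableEq V]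

/-- The easy half of the Erdős–Gallai theorem, in its weakest form. -/
theorem sum_vdeg_le (G : SimpleGraph V) (S : Finset V) :
    ∑ v ∈ S, vdeg G v ≤ S.card * (S.card - 1) + ∑ v ∈ Sᶜ, vdeg G v := by
  have h1 : ∀ v, vdeg G v = (∑ w ∈ S, if G.Adj v w then 1 else 0) +
      ∑ w ∈ Sᶜ, if G.Adj v w then 1 else 0 := fun v => by
    rw [vdeg_eq_sum, Finset.sum_add_sum_compl]
  have h2 : ∀ v ∈ S, (∑ w ∈ S, if G.Adj v w then 1 else 0) ≤ S.card - 1 := fun v hv => by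
    rw [← Finset.card_filter, ← Finset.card_erase_of_mem hv]
    refine Finset.card_le_card fun w hw => ?_
    rw [Finset.mem_filter] at hw
    exact Finset.mem_erase.2 ⟨hw.2.ne', hw.1⟩
  calc ∑ v ∈ S, vdeg G v
      = ∑ v ∈ S, (∑ w ∈ S, if G.Adj v w then 1 else 0) +
        ∑ v ∈ S, ∑ w ∈ Sᶜ, (if G.Adj v w then 1 else 0) := by
        rw [← Finset.sum_add_distrib]; exact Finset.sum_congr rfl fun v _ => h1 v
    _ ≤ S.card * (S.card - 1) + ∑ v ∈ Sᶜ, vdeg G v := by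
        refine add_le_add ?_ ?_
        · rw [← smul_eq_mul]
          exact Finset.sum_le_card_nsmul _ _ _ h2
        · rw [Finset.sum_comm]
          refine Finset.sum_le_sum fun w _ => ?_
          rw [h1 w]
          simp only [G.adj_comm w]
          exact Nat.le_add_right _ _

section swapOn

variable {G : SimpleGraph V} {y z : V} {S : Finset V}

theorem vdeg_swapOn_left (hy : y ∉ S) (hz : z ∉ S)
    (hS : (S.filter fun w => G.Adj y w).card = (S.filter fun w => G.Adj z w).card) :
    vdeg (swapOn G y z S) y = vdeg G y := by
  rw [vdeg_eq_sum, vdeg_eq_sum, ← Finset.sum_add_sum_compl S, ← Finset.sum_add_sum_compl S]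
  congr 1
  · rw [Finset.card_filter, Finset.card_filter] at hS
    rw [hS]
    refine Finset.sum_congr rfl fun w hw => ?_
    simp [swapOn_adj_left hy hz, hw]
  · refine Finset.sum_congr rfl fun w hw => ?_
    rw [Finset.mem_compl] at hw
    simp [swapOn_adj_left hy hz, hw]

/-- A vertex of `S` merely sees `y` and `z` interchanged, and by `hS` the vertices `y` and `z` trade
equally many neighbours. -/
theorem vdeg_swapOn (hyz : y ≠ z) (hy : y ∉ S) (hz : z ∉ S)
    (hS : (S.filter fun w => G.Adj y w).card = (S.filter fun w => G.Adj z w).card) (v : V) :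
    vdeg (swapOn G y z S) v = vdeg G v := by
  by_cases hvy : v = y
  · subst hvy; exact vdeg_swapOn_left hy hz hS
  by_cases hvz : v = z
  · subst hvz; rw [swapOn_comm]; exact vdeg_swapOn_left hz hy hS.symm
  by_cases hv : v ∈ S
  · rw [vdeg_eq_sum, vdeg_eq_sum, ← Equiv.sum_comp (Equiv.swap y z)]
    refine Finset.sum_congr rfl fun w _ => ?_
    by_cases hw : w = y ∨ w = z
    · rcases hw with rfl | rfl <;>
        simp [swapOn, hv, hvy, hvz, Equiv.swap_apply_of_ne_of_ne hvy hvz]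
    · rw [not_or] at hw
      simp [Equiv.swap_apply_of_ne_of_ne hw.1 hw.2, swapOn_adj_of_ne hvy hvz hw.1 hw.2]
  · refine congrArg Finset.card (Finset.filter_congr fun w _ => ?_)
    simp [swapOn, hv, hvy, hvz]

end swapOn

/-- On `T`, the only non-adjacent pairs of `G` are those whose labels are adjacent in `H`, and
no label is used twice: `G` contains on `T` a clique minus part of a copy of `H`. -/
def IsCliqueMinus {L : Type*} (H : SimpleGraph L) (G : SimpleGraph V) (T : Finset V)
    (φ : V → Option L) : Prop :=
  (∀ a ∈ T, ∀ b ∈ T, φ a ≠ none → φ a = φ b → a = b) ∧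
    ∀ a ∈ T, ∀ b ∈ T, a ≠ b → ¬ G.Adj a b → ∃ i j, φ a = some i ∧ φ b = some j ∧ H.Adj i j

/-- One vertex of a clique minus part of a copy of `H` can be replaced by any vertex of at least
the same degree. -/
theorem IsCliqueMinus.exchange {L : Type*} {H : SimpleGraph L} {G : SimpleGraph V} {T : Finset V}
    {φ : V → Option L} (h : IsCliqueMinus H G T φ) {x z : V} (hz : z ∈ T) (hx : x ∉ T)
    (hd : vdeg G z ≤ vdeg G x) :
    ∃ (G' : SimpleGraph V) (φ' : V → Option L), (∀ v, vdeg G' v = vdeg G v) ∧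
      IsCliqueMinus H G' (insert x (T.erase z)) φ' := by
  have hxz : x ≠ z := fun h => hx (h ▸ hz)
  -- `P` and `R` are the private neighbours of `z` and of `x`. The remaining neighbours correspond
  -- under the transposition of `x` and `z`, so the degree hypothesis compares `P` with `R`.
  set P := Finset.univ.filter fun w => G.Adj z w ∧ ¬ G.Adj x w ∧ w ≠ x with hP
  set R := Finset.univ.filter fun w => G.Adj x w ∧ ¬ G.Adj z w ∧ w ≠ z with hR
  have hcard : P.card ≤ R.card := by
    have e1 : vdeg G z = P.card +
        (Finset.univ.filter fun w => G.Adj z w ∧ (G.Adj x w ∨ w = x)).card := by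
      rw [vdeg, ← Finset.card_union_of_disjoint]
      · congr 1; ext w; simp [hP]; tauto
      · rw [hP]; exact Finset.disjoint_filter.2 fun w _ => by tauto
    have e2 : vdeg G x = R.card +
        (Finset.univ.filter fun w => G.Adj x w ∧ (G.Adj z w ∨ w = z)).card := by
      rw [vdeg, ← Finset.card_union_of_disjoint]
      · congr 1; ext w; simp [hR]; tauto
      · rw [hR]; exact Finset.disjoint_filter.2 fun w _ => by tauto
    have e3 : (Finset.univ.filter fun w => G.Adj z w ∧ (G.Adj x w ∨ w = x)).card =
        (Finset.univ.filter fun w => G.Adj x w ∧ (G.Adj z w ∨ w = z)).card := by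
      refine Finset.card_bij (fun w _ => Equiv.swap x z w) ?_
        (fun a _ b _ h => (Equiv.swap x z).injective h) ?_
      · intro w hw
        simp only [Finset.mem_filter, Finset.mem_univ, true_and] at hw ⊢
        rcases eq_or_ne w x with rfl | hwx
        · rw [Equiv.swap_apply_left]; exact ⟨hw.1.symm, Or.inr rfl⟩
        · have hwz : w ≠ z := hw.1.ne'
          rw [Equiv.swap_apply_of_ne_of_ne hwx hwz]
          tauto
      · intro w hw
        simp only [Finset.mem_filter, Finset.mem_univ, true_and] at hw
        refine ⟨Equiv.swap x z w, ?_, Equiv.swap_apply_self _ _ _⟩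
        simp only [Finset.mem_filter, Finset.mem_univ, true_and]
        rcases eq_or_ne w z with rfl | hwz
        · rw [Equiv.swap_apply_right]; exact ⟨hw.1.symm, Or.inr rfl⟩
        · have hwx : w ≠ x := hw.1.ne'
          rw [Equiv.swap_apply_of_ne_of_ne hwx hwz]
          tauto
    omega
  -- Trading all of `P` for equally many vertices of `R` makes `x` adjacent to every former
  -- neighbour of `z` other than `x` itself, so `x` can inherit the place and the label of `z`.
  obtain ⟨Q, hQR, hQ⟩ := Finset.exists_subset_card_eq hcard
  have memP : ∀ w, w ∈ P ↔ G.Adj z w ∧ ¬ G.Adj x w ∧ w ≠ x := by simp [hP]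
  have memQ : ∀ w ∈ Q, G.Adj x w ∧ ¬ G.Adj z w ∧ w ≠ z := fun w hw => by
    simpa [hR] using hQR hw
  have hxS : x ∉ P ∪ Q := by
    rw [Finset.mem_union, not_or]
    exact ⟨fun h => ((memP x).1 h).2.2 rfl, fun h => G.loopless.irrefl _ (memQ x h).1⟩
  have hzS : z ∉ P ∪ Q := by
    rw [Finset.mem_union, not_or]
    exact ⟨fun h => G.loopless.irrefl _ ((memP z).1 h).1, fun h => (memQ z h).2.2 rfl⟩
  have f1 : (P ∪ Q).filter (fun w => G.Adj x w) = Q := by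
    ext w
    simp only [Finset.mem_filter, Finset.mem_union]
    exact ⟨fun h => h.1.resolve_left fun hp => ((memP w).1 hp).2.1 h.2,
      fun h => ⟨Or.inr h, (memQ w h).1⟩⟩
  have f2 : (P ∪ Q).filter (fun w => G.Adj z w) = P := by
    ext w
    simp only [Finset.mem_filter, Finset.mem_union]
    exact ⟨fun h => h.1.resolve_right fun hp => (memQ w hp).2.1 h.2,
      fun h => ⟨Or.inl h, ((memP w).1 h).1⟩⟩
  have key : ∀ t, t ≠ x → G.Adj z t → (swapOn G x z (P ∪ Q)).Adj x t := by
    intro t htx ht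
    rw [swapOn_adj_left hxS hzS]
    by_cases htS : t ∈ P ∪ Q
    · simpa [htS] using ht
    · rw [if_neg htS]
      by_contra hc
      exact htS (Finset.mem_union_left _ ((memP t).2 ⟨ht, hc, htx⟩))
  refine ⟨swapOn G x z (P ∪ Q), fun v => φ (Equiv.swap x z v),
    vdeg_swapOn hxz hxS hzS (by rw [f1, f2, hQ]), ?_, ?_⟩
  · have hT : ∀ a ∈ insert x (T.erase z), Equiv.swap x z a ∈ T := by
      intro a ha
      rcases Finset.mem_insert.1 ha with rfl | ha
      · simpa using hz
      · have := Finset.mem_erase.1 ha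
        rw [Equiv.swap_apply_of_ne_of_ne (ne_of_mem_of_not_mem this.2 hx) this.1]
        exact this.2
    intro a ha b hb h1 h2
    exact (Equiv.swap x z).injective (h.1 _ (hT a ha) _ (hT b hb) h1 h2)
  · have hT : ∀ a ∈ T.erase z, a ≠ x ∧ a ≠ z ∧ a ∈ T := fun a ha => by
      have := Finset.mem_erase.1 ha
      exact ⟨ne_of_mem_of_not_mem this.2 hx, this.1, this.2⟩
    intro a ha b hb hab hadj
    rcases Finset.mem_insert.1 ha with hax | ha' <;>
      rcases Finset.mem_insert.1 hb with hbx | hb'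
    · exact absurd (hax.trans hbx.symm) hab
    · subst hax
      obtain ⟨h1, h2, h3⟩ := hT b hb'
      simp only [Equiv.swap_apply_left, Equiv.swap_apply_of_ne_of_ne h1 h2]
      exact h.2 _ hz _ h3 h2.symm fun hc => hadj (key b h1 hc)
    · subst hbx
      obtain ⟨h1, h2, h3⟩ := hT a ha'
      simp only [Equiv.swap_apply_left, Equiv.swap_apply_of_ne_of_ne h1 h2]
      exact h.2 _ h3 _ hz h2 fun hc => hadj (key a h1 hc.symm).symm
    · obtain ⟨h1, h2, h3⟩ := hT a ha'
      obtain ⟨h4, h5, h6⟩ := hT b hb'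
      simp only [Equiv.swap_apply_of_ne_of_ne h1 h2, Equiv.swap_apply_of_ne_of_ne h4 h5]
      rw [swapOn_adj_of_ne h1 h2 h4 h5] at hadj
      exact h.2 _ h3 _ h6 hab hadj

/-- A clique minus part of a copy of `H` can be moved into any set of vertices of top degree. -/
theorem IsCliqueMinus.exists_subset {L : Type*} {H : SimpleGraph L} {G : SimpleGraph V}
    {T X : Finset V} {φ : V → Option L} (h : IsCliqueMinus H G T φ) (hTX : T.card ≤ X.card)
    (hX : ∀ x ∈ X, ∀ z ∉ X, vdeg G z ≤ vdeg G x) :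
    ∃ (G' : SimpleGraph V) (T' : Finset V) (φ' : V → Option L), (∀ v, vdeg G' v = vdeg G v) ∧
      T' ⊆ X ∧ T'.card = T.card ∧ IsCliqueMinus H G' T' φ' := by
  induction hk : (T \ X).card generalizing G T φ with
  | zero =>
    refine ⟨G, T, φ, fun _ => rfl, ?_, rfl, h⟩
    rwa [Finset.card_eq_zero, Finset.sdiff_eq_empty_iff_subset] at hk
  | succ k ih =>
    obtain ⟨z, hz⟩ : (T \ X).Nonempty := Finset.card_pos.1 (by omega)
    obtain ⟨x, hx⟩ : (X \ T).Nonempty := Finset.card_pos.1 (by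
      have := Finset.card_sdiff_add_card_inter T X
      have := Finset.card_sdiff_add_card_inter X T
      rw [Finset.inter_comm] at this
      omega)
    rw [Finset.mem_sdiff] at hz hx
    obtain ⟨G₁, φ₁, hd, h₁⟩ := h.exchange hz.1 hx.2 (hX x hx.1 z hz.2)
    have hc : (insert x (T.erase z)).card = T.card := by
      rw [Finset.card_insert_of_notMem (fun h => hx.2 (Finset.mem_of_mem_erase h)),
        Finset.card_erase_add_one hz.1]
    have hs : insert x (T.erase z) \ X = (T \ X).erase z := by
      ext a
      simp only [Finset.mem_sdiff, Finset.mem_insert, Finset.mem_erase]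
      constructor
      · rintro ⟨rfl | h, h2⟩
        · exact absurd hx.1 h2
        · exact ⟨h.1, h.2, h2⟩
      · rintro ⟨h1, h2, h3⟩
        exact ⟨Or.inr ⟨h1, h2⟩, h3⟩
    obtain ⟨G₂, T₂, φ₂, hd₂, h2, h3, h4⟩ := ih h₁ (by omega)
      (fun x hx z hz => by rw [hd, hd]; exact hX x hx z hz)
      (by rw [hs, Finset.card_erase_of_mem (Finset.mem_sdiff.2 hz), hk]; rfl)
    exact ⟨G₂, T₂, φ₂, fun v => (hd₂ v).trans (hd v), h2, h3.trans hc, h4⟩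

/-- Havel–Hakimi: without changing degrees, `u` can be joined to all vertices of a set `X` of
vertices of top degree. -/
theorem exists_adj_top (G : SimpleGraph V) (u : V) (X : Finset V) (hu : u ∉ X)
    (hc : X.card ≤ vdeg G u) (hX : ∀ x ∈ X, ∀ y ∉ X, y ≠ u → vdeg G y < vdeg G x) :
    ∃ G' : SimpleGraph V, (∀ v, vdeg G' v = vdeg G v) ∧ ∀ x ∈ X, G'.Adj u x := by
  induction hk : (X.filter fun x => ¬ G.Adj u x).card generalizing G with
  | zero =>
    refine ⟨G, fun _ => rfl, fun x hx => ?_⟩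
    rw [Finset.card_eq_zero, Finset.filter_eq_empty_iff] at hk
    exact not_not.1 (hk hx)
  | succ k ih =>
    obtain ⟨x, hx⟩ := Finset.card_pos.1 (hk.symm ▸ Nat.succ_pos k :
      0 < (X.filter fun x => ¬ G.Adj u x).card)
    rw [Finset.mem_filter] at hx
    obtain ⟨y, hy, hyX⟩ : ∃ y, G.Adj u y ∧ y ∉ X := by
      by_contra hc'
      push Not at hc'
      have : (Finset.univ.filter fun w => G.Adj u w) ⊆ X.erase x := fun w hw => by
        have hw := (Finset.mem_filter.1 hw).2
        exact Finset.mem_erase.2 ⟨fun h => hx.2 (h ▸ hw), hc' w hw⟩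
      have h1 := Finset.card_le_card this
      rw [Finset.card_erase_of_mem hx.1] at h1
      have h2 := Finset.card_pos.2 ⟨x, hx.1⟩
      rw [vdeg] at hc
      omega
    have hxy : x ≠ y := fun h => hyX (h ▸ hx.1)
    have hlt := hX x hx.1 y hyX hy.ne'
    -- Since `x` has larger degree than `y`, it has a neighbour `p` that `y` lacks: `u y` and `x p`
    -- are edges, `u x` and `y p` are not, and the switch preserves degrees.
    obtain ⟨p, hxp, hyp, hpy⟩ : ∃ p, G.Adj x p ∧ ¬ G.Adj y p ∧ p ≠ y := by
      by_contra hc'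
      push Not at hc'
      refine absurd hlt (not_lt.2 ?_)
      rw [vdeg, vdeg]
      refine Finset.card_le_card_of_injOn (Equiv.swap x y) ?_ (Equiv.swap x y).injective.injOn
      intro w hw
      simp only [Finset.coe_filter, Finset.mem_univ, true_and, Set.mem_ofPred_eq] at hw ⊢
      rcases eq_or_ne w y with rfl | hwy
      · rw [Equiv.swap_apply_right]; exact hw.symm
      · rw [Equiv.swap_apply_of_ne_of_ne hw.ne' hwy]
        by_contra hq
        exact hwy (hc' w hw hq)
    have hpu : p ≠ u := fun h => hx.2 (h ▸ hxp).symm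
    have hxu : x ≠ u := fun h => hu (h ▸ hx.1)
    have hxS : x ∉ ({u, p} : Finset V) := by simp [hxu, hxp.ne]
    have hyS : y ∉ ({u, p} : Finset V) := by simp [hy.ne', hpy.symm]
    have hux : ¬ G.Adj x u := fun h => hx.2 h.symm
    have hd := vdeg_swapOn (G := G) hxy hxS hyS (by
      rw [Finset.filter_insert, Finset.filter_insert, if_neg hux, if_pos hy.symm,
        Finset.filter_singleton, Finset.filter_singleton, if_pos hxp, if_neg hyp]
      simp)
    have ha : ∀ w, w ≠ x → w ≠ y → ((swapOn G x y {u, p}).Adj u w ↔ G.Adj u w) := fun w h1 h2 =>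
      swapOn_adj_of_ne hxu.symm hy.ne h1 h2
    have hax : (swapOn G x y {u, p}).Adj u x := by
      rw [SimpleGraph.adj_comm, swapOn_adj_left hxS hyS, if_pos (by simp)]
      exact hy.symm
    obtain ⟨G', hG', h2⟩ := ih (swapOn G x y {u, p}) (by rw [hd]; exact hc)
      (fun x hx y hy hyu => by rw [hd, hd]; exact hX x hx y hy hyu) (by
        have : (X.filter fun w => ¬ (swapOn G x y {u, p}).Adj u w) =
            (X.filter fun w => ¬ G.Adj u w).erase x := by
          ext w
          simp only [Finset.mem_filter, Finset.mem_erase]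
          constructor
          · rintro ⟨h1, h2⟩
            have hwx : w ≠ x := fun h => h2 (h ▸ hax)
            exact ⟨hwx, h1, fun h => h2 ((ha w hwx fun h => hyX (h ▸ h1)).2 h)⟩
          · rintro ⟨h1, h2, h3⟩
            exact ⟨h2, fun h => h3 ((ha w h1 fun h => hyX (h ▸ h2)).1 h)⟩
        rw [this, Finset.card_erase_of_mem (Finset.mem_filter.2 hx), hk]
        rfl)
    exact ⟨G', fun v => (hG' v).trans (hd v), h2⟩

end Degrees

/-! ### Constructing graphs with prescribed degrees. -/

section Realization

open scoped Classical

theorem exists_top_subset {V : Type*} (f : V → ℕ) (O : Finset V) {k : ℕ} (hk : k ≤ O.card) :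
    ∃ A ⊆ O, A.card = k ∧ ∀ a ∈ A, ∀ b ∈ O, b ∉ A → f b ≤ f a := by
  induction k with
  | zero => exact ⟨∅, by simp⟩
  | succ k ih =>
    obtain ⟨A, hA, hc, ht⟩ := ih (by omega)
    obtain ⟨x, hx, hmax⟩ := Finset.exists_max_image (O \ A) f (Finset.card_pos.1 (by
      rw [Finset.card_sdiff_of_subset hA]; omega))
    rw [Finset.mem_sdiff] at hx
    refine ⟨insert x A, Finset.insert_subset hx.1 hA, by
      rw [Finset.card_insert_of_notMem hx.2, hc], ?_⟩
    intro a ha b hb hbA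
    rw [Finset.mem_insert, not_or] at hbA
    rcases Finset.mem_insert.1 ha with rfl | ha
    · exact hmax b (Finset.mem_sdiff.2 ⟨hb, hbA.2⟩)
    · exact ht a ha b hb hbA.2

/-- Join the vertex `v` to all vertices of `A`. -/
def addStar {V : Type*} (G : SimpleGraph V) (v : V) (A : Finset V) (hv : v ∉ A) :
    SimpleGraph V where
  Adj a b := G.Adj a b ∨ (a = v ∧ b ∈ A) ∨ (b = v ∧ a ∈ A)
  symm := ⟨fun a b h => by rw [G.adj_comm]; tauto⟩
  loopless := ⟨fun a h => by
    rcases h with h | ⟨rfl, h⟩ | ⟨rfl, h⟩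
    · exact G.loopless.irrefl _ h
    · exact hv h
    · exact hv h⟩

theorem addStar_adj {V : Type*} {G : SimpleGraph V} {v : V} {A : Finset V} {hv : v ∉ A}
    {a b : V} : (addStar G v A hv).Adj a b ↔ G.Adj a b ∨ (a = v ∧ b ∈ A) ∨ (b = v ∧ a ∈ A) :=
  Iff.rfl

/-- The complete graph on `T`, without the edges of `E`. -/
def cliqueWithout {V : Type*} (T : Finset V) (E : SimpleGraph V) : SimpleGraph V where
  Adj a b := a ≠ b ∧ a ∈ T ∧ b ∈ T ∧ ¬ E.Adj a b
  symm := ⟨fun _ _ h => ⟨h.1.symm, h.2.2.1, h.2.1, fun h' => h.2.2.2 h'.symm⟩⟩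
  loopless := ⟨fun _ h => h.1 rfl⟩

theorem cliqueWithout_adj {V : Type*} {T : Finset V} {E : SimpleGraph V} {a b : V} :
    (cliqueWithout T E).Adj a b ↔ a ≠ b ∧ a ∈ T ∧ b ∈ T ∧ ¬ E.Adj a b :=
  Iff.rfl

variable {V : Type*} [Fintype V] [DecidableEq V]

theorem vdeg_addStar_self {G : SimpleGraph V} {v : V} {A : Finset V} (hv : v ∉ A)
    (h0 : vdeg G v = 0) : vdeg (addStar G v A hv) v = A.card := by
  rw [vdeg]
  congr 1
  ext w
  have := vdeg_eq_zero.1 h0 w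
  simp only [addStar_adj, Finset.mem_filter, Finset.mem_univ, true_and]
  constructor
  · rintro (h | h | ⟨rfl, h⟩)
    · exact absurd h this
    · exact h
    · exact absurd h hv
  · exact fun h => Or.inr (Or.inl h)

theorem vdeg_addStar_of_mem {G : SimpleGraph V} {v w : V} {A : Finset V} (hv : v ∉ A)
    (h0 : vdeg G v = 0) (hw : w ∈ A) : vdeg (addStar G v A hv) w = vdeg G w + 1 := by
  have hwv : w ≠ v := fun h => hv (h ▸ hw)
  have : ¬ G.Adj w v := fun h => vdeg_eq_zero.1 h0 w h.symm
  rw [vdeg, vdeg, ← Finset.card_insert_of_notMem (a := v) (by simpa using this)]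
  congr 1
  ext u
  simp only [addStar_adj, Finset.mem_filter, Finset.mem_univ, true_and, Finset.mem_insert]
  tauto

theorem vdeg_addStar_of_notMem {G : SimpleGraph V} {v w : V} {A : Finset V} (hv : v ∉ A)
    (hwv : w ≠ v) (hw : w ∉ A) : vdeg (addStar G v A hv) w = vdeg G w := by
  rw [vdeg, vdeg]
  congr 1
  ext u
  simp only [addStar_adj, Finset.mem_filter, Finset.mem_univ, true_and]
  tauto

/-- A function with even sum whose `x + 1` largest values are all `x` or `x - 1` is the degree
function of a graph. -/
theorem exists_vdeg_eq_of_almost_flat (b : V → ℕ) (x : ℕ) (hb : ∀ v, b v ≤ x)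
    (hc : x + 1 ≤ (Finset.univ.filter fun v => x ≤ b v + 1).card) (he : Even (∑ v, b v)) :
    ∃ G : SimpleGraph V, ∀ v, vdeg G v = b v := by
  induction hk : (∑ v, b v) + x using Nat.strong_induction_on generalizing b x with
  | _ k ih =>
  subst hk
  rcases x with _ | y
  · exact ⟨⊥, fun v => by simp [vdeg, Nat.le_zero.1 (hb v)]⟩
  by_cases hv : ∃ v, b v = y + 1
  swap
  · push Not at hv
    refine ih _ (by omega) b y (fun v => ?_) (le_trans (by omega) (le_trans hc ?_)) he rfl
    · have := hb v
      have := hv v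
      omega
    · refine Finset.card_le_card fun v => ?_
      simp only [Finset.mem_filter, Finset.mem_univ, true_and]
      omega
  obtain ⟨v, hv⟩ := hv
  set X := Finset.univ.filter fun v => y + 1 ≤ b v + 1 with hX
  have hvX : v ∈ X := by simp [hX, hv]
  have hXe : (X.erase v).card + 1 = X.card := Finset.card_erase_add_one hvX
  obtain ⟨A, hA, hAc, hAt⟩ := exists_top_subset b (Finset.univ.erase v) (k := y + 1) (by
    have := Finset.card_le_card (Finset.erase_subset_erase v (Finset.subset_univ X))
    omega)
  have hvA : v ∉ A := fun h => Finset.notMem_erase v _ (hA h)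
  have hAy : ∀ a ∈ A, y ≤ b a := by
    intro a ha
    by_contra hlt
    have hsub : X.erase v ⊆ A.erase a := by
      intro w hw
      have hw' := Finset.mem_erase.1 hw
      have hyw : y ≤ b w := by
        have := hw'.2
        simp only [hX, Finset.mem_filter, Finset.mem_univ, true_and] at this
        omega
      refine Finset.mem_erase.2 ⟨fun h => hlt (h ▸ hyw), ?_⟩
      by_contra hwA
      have := hAt a ha w (Finset.mem_erase.2 ⟨hw'.1, Finset.mem_univ _⟩) hwA
      omega
    have := Finset.card_le_card hsub
    rw [Finset.card_erase_of_mem ha] at this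
    omega
  -- This can fail only for `y = 0`; then `v` carries the only nonzero value, which is 1, against
  -- the even sum.
  have hApos : ∀ a ∈ A, 1 ≤ b a := by
    intro a ha
    by_contra hlt
    have hy : y = 0 := by have := hAy a ha; omega
    subst hy
    obtain ⟨a', rfl⟩ := Finset.card_eq_one.1 hAc
    rw [Finset.mem_singleton] at ha
    subst ha
    have hz : ∀ w, w ≠ v → b w = 0 := by
      intro w hw
      rcases eq_or_ne w a with rfl | hwa
      · omega
      · have := hAt a (by simp) w (by simp [hw]) (by simpa using hwa)
        omega
    rw [Finset.sum_eq_single v (fun w _ hw => hz w hw) (by simp), hv] at he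
    simp at he
  set b' : V → ℕ := fun w => if w = v then 0 else if w ∈ A then b w - 1 else b w with hb'
  have hb'v : b' v = 0 := by simp [hb']
  have hb'A : ∀ w ∈ A, b' w + 1 = b w := by
    intro w hw
    have hwv : w ≠ v := fun h => hvA (h ▸ hw)
    have := hApos w hw
    simp only [hb', hwv, if_false, hw, if_true]
    omega
  have hb'n : ∀ w, w ≠ v → w ∉ A → b' w = b w := by
    intro w hwv hw
    simp [hb', hwv, hw]
  have hsum : ∑ w, b w = ∑ w, b' w + 2 * (y + 1) := by
    have h1 : ∀ w, b w = b' w + ((if w ∈ A then 1 else 0) + if w = v then y + 1 else 0) := by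
      intro w
      by_cases hwv : w = v
      · subst hwv; simp [hb'v, hv, hvA]
      · by_cases hw : w ∈ A
        · simp [hw, hwv, hb'A w hw]
        · simp [hw, hwv, hb'n w hwv hw]
    rw [Finset.sum_congr rfl fun w _ => h1 w, Finset.sum_add_distrib, Finset.sum_add_distrib]
    simp [hAc]
    omega
  have he' : Even (∑ w, b' w) := by
    rw [hsum] at he
    exact (Nat.even_add.1 he).2 (even_two_mul _)
  have main : ∃ G : SimpleGraph V, ∀ w, vdeg G w = b' w := by
    -- If the value `y + 1` survives at `w`, then `w` was not chosen, so every vertex of `A` had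
    -- value `y + 1` and now has `y`; together with `w` they are the `y + 2` vertices required.
    -- Otherwise the bound drops to `y` and `A` alone suffices.
    by_cases hw : ∃ w, b' w = y + 1
    · obtain ⟨w, hw⟩ := hw
      have hwv : w ≠ v := fun h => by rw [h, hb'v] at hw; omega
      have hwA : w ∉ A := fun h => by
        have h1 := hb'A w h
        have h2 := hb w
        omega
      have hAw : ∀ a ∈ A, y + 1 ≤ b a := fun a ha => by
        have := hAt a ha w (by simp [hwv]) hwA
        rw [← hb'n w hwv hwA] at this
        omega
      refine ih _ ?_ b' (y + 1) ?_ ?_ he' rfl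
      · omega
      · intro u
        refine le_trans ?_ (hb u)
        simp only [hb']
        split_ifs <;> omega
      · have h1 : insert w A ⊆ Finset.univ.filter fun v => y + 1 ≤ b' v + 1 := by
          intro u hu
          rw [Finset.mem_filter]
          refine ⟨Finset.mem_univ _, ?_⟩
          rcases Finset.mem_insert.1 hu with rfl | hu
          · omega
          · have := hb'A u hu
            have := hAw u hu
            omega
        have := Finset.card_le_card h1
        rw [Finset.card_insert_of_notMem hwA, hAc] at this
        exact this
    · push Not at hw
      refine ih _ ?_ b' y ?_ ?_ he' rfl
      · omega
      · intro u
        have h1 := hb u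
        have h2 := hw u
        have h3 : b' u ≤ b u := by
          simp only [hb']
          split_ifs <;> omega
        omega
      · rw [← hAc]
        refine Finset.card_le_card fun u hu => ?_
        rw [Finset.mem_filter]
        have := hb'A u hu
        have := hAy u hu
        exact ⟨Finset.mem_univ _, by omega⟩
  obtain ⟨G, hG⟩ := main
  have h0 : vdeg G v = 0 := by rw [hG, hb'v]
  refine ⟨addStar G v A hvA, fun w => ?_⟩
  by_cases hwv : w = v
  · subst hwv
    rw [vdeg_addStar_self hvA h0, hAc, hv]
  by_cases hw : w ∈ A
  · rw [vdeg_addStar_of_mem hvA h0 hw, hG, hb'A w hw]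
  · rw [vdeg_addStar_of_notMem hvA hwv hw, hG, hb'n w hwv hw]

/-- A bipartite graph between `T` and `O` with degrees `c` on `T`, which lowers the demands `b`
on `O` in a balanced way. -/
theorem exists_balanced (O : Finset V) (b c : V → ℕ) (m : ℕ) (hb : ∀ v ∈ O, b v ≤ m)
    (T : Finset V) (hTO : Disjoint T O) (hc : ∀ t ∈ T, c t ≤ (O.filter fun v => b v = m).card)
    (hs : ∑ t ∈ T, c t ≤ ∑ v ∈ O, b v) :
    ∃ (G : SimpleGraph V) (a : V → ℕ),
      (∀ u w, G.Adj u w → (u ∈ T ∧ w ∈ O) ∨ (u ∈ O ∧ w ∈ T)) ∧ (∀ t ∈ T, vdeg G t = c t) ∧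
      (∀ v ∈ O, vdeg G v + a v = b v) ∧ ∑ v ∈ O, a v + ∑ t ∈ T, c t = ∑ v ∈ O, b v ∧
      ∀ w ∈ O, a w < b w → ∀ v ∈ O, a v ≤ a w + 1 := by
  induction T using Finset.induction_on with
  | empty =>
    exact ⟨⊥, b, by simp, by simp, by simp [vdeg], by simp, fun w _ h => absurd h (lt_irrefl _)⟩
  | insert t T ht ih =>
    rw [Finset.sum_insert ht] at hs
    obtain ⟨htO, hTO'⟩ := Finset.disjoint_insert_left.1 hTO
    obtain ⟨G, a, hG, hGT, hGO, hsum, hbal⟩ := ih hTO'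
      (fun s hs => hc s (Finset.mem_insert_of_mem hs)) (by omega)
    set K := O.filter fun v => b v = m with hK
    have hKO : K ⊆ O := Finset.filter_subset _ _
    have hct := hc t (Finset.mem_insert_self _ _)
    -- Greedy choice: `t` is joined to the vertices whose current demand is largest, which keeps
    -- every vertex lowered so far within 1 of the maximum.
    obtain ⟨A, hA, hAc, hAt⟩ := exists_top_subset a O (hct.trans (Finset.card_le_card hKO))
    have htA : t ∉ A := fun h => htO (hA h)
    have h0 : vdeg G t = 0 := vdeg_eq_zero.2 fun w hw => by
      rcases hG t w hw with h | h
      · exact ht h.1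
      · exact htO h.1
    have hab : ∀ v ∈ O, a v ≤ b v := fun v hv => by have := hGO v hv; omega
    -- Because `A` is no larger than `K`, a choice outside `K` skips some `f` in `K`. Such an `f`
    -- has demand at most that of `w`, which is below `m`, so it was lowered earlier and the balance
    -- hypothesis applies to it.
    have hKA : ∀ w ∈ A, w ∉ K → ∃ f ∈ K, f ∉ A := by
      intro w hw hwK
      by_contra hcon
      push Not at hcon
      have := Finset.card_lt_card (Finset.ssubset_iff_subset_ne.2
        ⟨hcon, fun h => hwK (h ▸ hw)⟩)
      omega
    -- A zero demand in `A` would force demand zero outside `A` and at most 1 inside, so that less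
    -- than `c t` would remain in total.
    have hApos : ∀ v ∈ A, 1 ≤ a v := by
      intro v hv
      by_contra hlt
      have hv0 : a v = 0 := by omega
      have hAcard : 0 < A.card := Finset.card_pos.2 ⟨v, hv⟩
      obtain ⟨f, hfK, hf0⟩ : ∃ f ∈ K, a f = 0 := by
        by_cases hvK : v ∈ K
        · exact ⟨v, hvK, hv0⟩
        · obtain ⟨f, hf, hfA⟩ := hKA v hv hvK
          have := hAt v hv f (hKO hf) hfA
          exact ⟨f, hf, by omega⟩
      obtain ⟨hfO, hfm⟩ := Finset.mem_filter.1 hfK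
      have h1 : ∀ u ∈ O, a u ≤ 1 := by
        intro u hu
        by_cases hm : m = 0
        · have := hb u hu
          have := hab u hu
          omega
        · have := hbal f hfO (by omega) u hu
          omega
      have h2 : ∑ u ∈ O, a u < A.card := by
        have h3 : ∑ u ∈ O, a u = ∑ u ∈ A, a u := by
          refine (Finset.sum_subset hA fun u hu huA => ?_).symm
          have := hAt v hv u hu huA
          omega
        rw [h3, Finset.card_eq_sum_ones]
        exact Finset.sum_lt_sum (fun u hu => h1 u (hA hu)) ⟨v, hv, by omega⟩
      omega
    refine ⟨addStar G t A htA, fun v => if v ∈ A then a v - 1 else a v, ?_, ?_, ?_, ?_, ?_⟩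
    · rintro u w (h | ⟨rfl, h⟩ | ⟨rfl, h⟩)
      · rcases hG u w h with h | h
        · exact Or.inl ⟨Finset.mem_insert_of_mem h.1, h.2⟩
        · exact Or.inr ⟨h.1, Finset.mem_insert_of_mem h.2⟩
      · exact Or.inl ⟨Finset.mem_insert_self _ _, hA h⟩
      · exact Or.inr ⟨hA h, Finset.mem_insert_self _ _⟩
    · intro s hs
      rcases Finset.mem_insert.1 hs with rfl | hs
      · rw [vdeg_addStar_self htA h0, hAc]
      · rw [vdeg_addStar_of_notMem htA (fun h => ht (h ▸ hs))
          (fun h => Finset.disjoint_left.1 hTO' hs (hA h)), hGT s hs]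
    · intro v hv
      by_cases hvA : v ∈ A
      · rw [vdeg_addStar_of_mem htA h0 hvA, ← hGO v hv]
        simp only [hvA, if_true]
        have := hApos v hvA
        omega
      · rw [vdeg_addStar_of_notMem htA (fun h => htO (h ▸ hv)) hvA]
        simp only [hvA, if_false]
        exact hGO v hv
    · rw [Finset.sum_insert ht, ← hsum, ← hAc, Finset.card_eq_sum_ones, ← add_assoc]
      congr 1
      have : ∑ v ∈ A, 1 = ∑ v ∈ O, if v ∈ A then 1 else 0 := by
        rw [← Finset.sum_filter, Finset.filter_mem_eq_inter, Finset.inter_eq_right.2 hA]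
      rw [this, ← Finset.sum_add_distrib]
      refine Finset.sum_congr rfl fun v _ => ?_
      split_ifs with h
      · have := hApos v h
        omega
      · rfl
    · intro w hw hlt v hv
      by_cases hold : a w < b w
      · have h1 := hbal w hw hold v hv
        by_cases hwA : w ∈ A
        · have hw1 := hApos w hwA
          by_cases hvA : v ∈ A
          · simp only [hwA, hvA, if_true]; omega
          · have := hAt w hwA v hv hvA
            simp only [hwA, hvA, if_true, if_false]; omega
        · simp only [hwA, if_false]
          split_ifs <;> omega
      · have hwA : w ∈ A := by
          by_contra hwA
          simp only [hwA, if_false] at hlt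
          exact hold hlt
        have hw1 := hApos w hwA
        have hle : a v ≤ a w + 1 := by
          by_cases hwK : w ∈ K
          · have := (Finset.mem_filter.1 hwK).2
            have := hab v hv
            have := hb v hv
            omega
          · obtain ⟨f, hf, hfA⟩ := hKA w hwA hwK
            have h1 := hAt w hwA f (hKO hf) hfA
            have h2 := (Finset.mem_filter.1 hf).2
            have h3 := hb w hw
            have h4 : b w ≠ m := fun h => hwK (Finset.mem_filter.2 ⟨hw, h⟩)
            have h5 := hab w hw
            have := hbal f (hKO hf) (by omega) v hv
            omega
        by_cases hvA : v ∈ A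
        · simp only [hwA, hvA, if_true]; omega
        · have := hAt w hwA v hv hvA
          simp only [hwA, hvA, if_true, if_false]; omega

theorem vdeg_cliqueWithout {T : Finset V} {E : SimpleGraph V} (hE : ∀ u v, E.Adj u v → u ∈ T)
    {t : V} (ht : t ∈ T) : vdeg (cliqueWithout T E) t + vdeg E t + 1 = T.card := by
  rw [← Finset.card_erase_add_one ht, vdeg, vdeg, ← Finset.card_union_of_disjoint]
  · congr 2
    ext w
    simp only [Finset.mem_union, Finset.mem_filter, Finset.mem_univ, true_and, Finset.mem_erase,
      cliqueWithout_adj]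
    constructor
    · rintro (h | h)
      · exact ⟨h.1.symm, h.2.2.1⟩
      · exact ⟨h.ne', hE w t h.symm⟩
    · rintro ⟨h1, h2⟩
      by_cases h : E.Adj t w
      · exact Or.inr h
      · exact Or.inl ⟨h1.symm, ht, h2, h⟩
  · exact Finset.disjoint_filter.2 fun w _ h => h.2.2.2

theorem vdeg_cliqueWithout_of_notMem {V : Type*} [Fintype V] {T : Finset V} {E : SimpleGraph V}
    {t : V} (ht : t ∉ T) :
    vdeg (cliqueWithout T E) t = 0 :=
  vdeg_eq_zero.2 fun _ h => ht h.2.1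

/-- A sufficient condition for `d` to have a realization in which `T` induces the complete graph
without the edges of `E`. -/
theorem exists_vdeg_eq_cliqueWithout (d : V → ℕ) (T : Finset V) (E : SimpleGraph V) (r m : ℕ)
    (hT : T.card = r + 1) (hE : ∀ u v, E.Adj u v → u ∈ T)
    (hlow : ∀ t ∈ T, r ≤ d t + vdeg E t)
    (hup : ∀ t ∈ T, d t + vdeg E t ≤ r + (Tᶜ.filter fun v => d v = m).card)
    (hO : ∀ v ∈ Tᶜ, d v ≤ m)
    (hs : ∑ t ∈ T, (d t + vdeg E t) ≤ r * (r + 1) + ∑ v ∈ Tᶜ, d v)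
    (he : Even (∑ v, d v)) (hne : Tᶜ.Nonempty)
    (hfin : ∀ x N, x ≤ m → (Tᶜ.filter fun v => x ≤ d v + 1).card ≤ N →
      ∑ t ∈ T, (d t + vdeg E t) + 1 ≤ r * (r + 1) + N * (m + 1 - x) → x + 1 ≤ N) :
    ∃ G : SimpleGraph V, (∀ v, vdeg G v = d v) ∧
      ∀ a ∈ T, ∀ b ∈ T, a ≠ b → ¬ E.Adj a b → G.Adj a b := by
  -- The number of edges that `t` must send outside `T`.
  set c : V → ℕ := fun t => d t + vdeg E t - r with hc
  have hcsum : ∑ t ∈ T, (d t + vdeg E t) = ∑ t ∈ T, c t + r * (r + 1) := by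
    have h1 : ∀ t ∈ T, d t + vdeg E t = c t + r := fun t ht => by
      have := hlow t ht
      simp only [hc]
      omega
    rw [Finset.sum_congr rfl h1, Finset.sum_add_distrib, Finset.sum_const, hT, smul_eq_mul,
      mul_comm r]
  obtain ⟨B, a, hB, hBT, hBO, hsum, hbal⟩ := exists_balanced Tᶜ d c m hO T disjoint_compl_right
    (fun t ht => by have := hup t ht; simp only [hc]; omega) (by omega)
  obtain ⟨w₀, hw₀, hmax⟩ := Finset.exists_max_image Tᶜ a hne
  set x := a w₀ with hx
  have had : ∀ v ∈ Tᶜ, a v ≤ d v := fun v hv => by have := hBO v hv; omega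
  have hxm : x ≤ m := (had w₀ hw₀).trans (hO w₀ hw₀)
  set Q := Tᶜ.filter fun v => x ≤ a v + 1 with hQ
  have hQd : (Tᶜ.filter fun v => x ≤ d v + 1) ⊆ Q := by
    intro v hv
    rw [Finset.mem_filter] at hv
    refine Finset.mem_filter.2 ⟨hv.1, ?_⟩
    rcases (had v hv.1).lt_or_eq with h | h
    · exact hbal v hv.1 h w₀ hw₀
    · rw [h]; exact hv.2
  have hQc : x + 1 ≤ Q.card := by
    refine hfin x Q.card hxm (Finset.card_le_card hQd) ?_
    -- Only vertices of `Q` have been lowered, each by at most `m + 1 - x`, and `w₀` by at most `m -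
    -- x`; the last fact gives the extra 1.
    have h1 : ∑ v ∈ Tᶜ, d v + 1 ≤ ∑ v ∈ Tᶜ, a v + Q.card * (m + 1 - x) := by
      have h2 : Q.card * (m + 1 - x) = ∑ v ∈ Tᶜ, if v ∈ Q then m + 1 - x else 0 := by
        rw [← Finset.sum_filter, Finset.filter_mem_eq_inter,
          Finset.inter_eq_right.2 (Finset.filter_subset _ _), Finset.sum_const, smul_eq_mul]
      rw [h2, ← Finset.sum_add_distrib, Nat.add_one_le_iff]
      refine Finset.sum_lt_sum (fun v hv => ?_) ⟨w₀, hw₀, ?_⟩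
      · have := hO v hv
        split_ifs with hvQ
        · have := (Finset.mem_filter.1 hvQ).2
          omega
        · have h3 := had v hv
          by_contra hlt
          exact hvQ (Finset.mem_filter.2 ⟨hv, hbal v hv (by omega) w₀ hw₀⟩)
      · have hwQ : w₀ ∈ Q := Finset.mem_filter.2 ⟨hw₀, Nat.le_succ _⟩
        have := hO w₀ hw₀
        rw [if_pos hwQ]
        omega
    omega
  set b' : V → ℕ := fun v => if v ∈ T then 0 else a v with hb'
  have hb'T : ∀ v ∈ T, b' v = 0 := fun v hv => by simp [hb', hv]
  have hb'O : ∀ v ∉ T, b' v = a v := fun v hv => by simp [hb', hv]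
  have hb'sum : ∑ v, b' v = ∑ v ∈ Tᶜ, a v := by
    rw [← Finset.sum_add_sum_compl T, Finset.sum_eq_zero hb'T, zero_add]
    exact Finset.sum_congr rfl fun v hv => hb'O v (Finset.mem_compl.1 hv)
  have heven : Even (∑ v, b' v) := by
    have h1 : ∑ v, vdeg E v = ∑ v ∈ T, vdeg E v := by
      refine (Finset.sum_subset (Finset.subset_univ T) fun v _ hv => ?_).symm
      exact vdeg_eq_zero.2 fun w hw => hv (hE v w hw)
    have h2 := even_sum_vdeg E
    have h3 := Nat.even_mul_succ_self r
    rw [← Finset.sum_add_sum_compl T] at he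
    rw [Finset.sum_add_distrib] at hcsum
    rw [h1] at h2
    rw [hb'sum]
    rw [Nat.even_iff] at *
    omega
  obtain ⟨D, hD⟩ := exists_vdeg_eq_of_almost_flat b' x (fun v => by
    by_cases hv : v ∈ T
    · rw [hb'T v hv]; exact Nat.zero_le _
    · rw [hb'O v hv]; exact hmax v (Finset.mem_compl.2 hv)) (by
    refine hQc.trans (Finset.card_le_card fun v hv => ?_)
    have := Finset.mem_filter.1 hv
    refine Finset.mem_filter.2 ⟨Finset.mem_univ _, ?_⟩
    rw [hb'O v (Finset.mem_compl.1 this.1)]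
    exact this.2) heven
  have hDT : ∀ t ∈ T, ∀ w, ¬ D.Adj t w := fun t ht => vdeg_eq_zero.1 (by rw [hD, hb'T t ht])
  refine ⟨cliqueWithout T E ⊔ (B ⊔ D), fun v => ?_, fun a ha b hb hab h =>
    Or.inl ⟨hab, ha, hb, h⟩⟩
  have hBD : ∀ w, B.Adj v w → ¬ D.Adj v w := by
    intro w h1 h2
    rcases hB v w h1 with h | h
    · exact hDT v h.1 w h2
    · exact hDT w h.2 v h2.symm
  have hCBD : ∀ w, (cliqueWithout T E).Adj v w → ¬ (B ⊔ D).Adj v w := by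
    rintro w ⟨-, h1, h2, -⟩ (h | h)
    · rcases hB v w h with h | h
      · exact Finset.mem_compl.1 h.2 h2
      · exact Finset.mem_compl.1 h.1 h1
    · exact hDT v h1 w h
  rw [vdeg_sup hCBD, vdeg_sup hBD, hD]
  by_cases hv : v ∈ T
  · have h1 := vdeg_cliqueWithout hE hv
    have h2 := hlow v hv
    rw [hBT v hv, hb'T v hv]
    simp only [hc]
    omega
  · rw [vdeg_cliqueWithout_of_notMem hv, hb'O v hv, hBO v (Finset.mem_compl.2 hv), zero_add]

end Realization

/-! ### Labels for the missing edges. -/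

section Labels

open scoped Classical

variable {V : Type*}

theorem exists_isCliqueMinus_of_embedding {L : Type*} {H : SimpleGraph L} {G E : SimpleGraph V}
    {T : Finset V} (p : L ↪ V)
    (hE : ∀ a b, E.Adj a b → ∃ i j, p i = a ∧ p j = b ∧ H.Adj i j)
    (hG : ∀ a ∈ T, ∀ b ∈ T, a ≠ b → ¬ E.Adj a b → G.Adj a b) :
    ∃ φ, IsCliqueMinus H G T φ := by
  have hφ : ∀ i, (if h : ∃ l, p l = p i then some h.choose else none) = some i := fun i => by
    have h : ∃ l, p l = p i := ⟨i, rfl⟩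
    rw [dif_pos h, p.injective h.choose_spec]
  refine ⟨fun v => if h : ∃ l, p l = v then some h.choose else none, ?_, ?_⟩
  · intro a _ b _ ha hab
    by_cases h : ∃ l, p l = a
    · by_cases h' : ∃ l, p l = b
      · obtain ⟨i, rfl⟩ := h
        obtain ⟨j, rfl⟩ := h'
        simp only [hφ, Option.some.injEq] at hab
        rw [hab]
      · simp only [dif_pos h, dif_neg h'] at hab
        exact absurd hab (by simp)
    · simp [dif_neg h] at ha
  · intro a ha b hb hab hadj
    obtain ⟨i, j, rfl, rfl, hij⟩ := hE a b (by
      by_contra h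
      exact hadj (hG a ha b hb hab h))
    exact ⟨i, j, hφ i, hφ j, hij⟩

variable [Fintype V]

theorem vdeg_bot (v : V) : vdeg (⊥ : SimpleGraph V) v = 0 := by simp [vdeg]

variable [DecidableEq V]

theorem vdeg_edge {a b : V} (hab : a ≠ b) (v : V) :
    vdeg (SimpleGraph.edge a b) v = (if v = a then 1 else 0) + if v = b then 1 else 0 := by
  rw [vdeg]
  by_cases hva : v = a
  · subst hva
    rw [if_pos rfl, if_neg hab, Finset.card_eq_one]
    exact ⟨b, by ext w; simp [SimpleGraph.edge_adj]; grind⟩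
  by_cases hvb : v = b
  · subst hvb
    rw [if_pos rfl, if_neg hab.symm, Finset.card_eq_one]
    exact ⟨a, by ext w; simp [SimpleGraph.edge_adj]; grind⟩
  · rw [if_neg hva, if_neg hvb, Finset.card_eq_zero]
    ext w
    simp [SimpleGraph.edge_adj]
    grind

theorem vdeg_sup_edge {G : SimpleGraph V} {a b : V} (hab : a ≠ b) (h : ¬ G.Adj a b) (v : V) :
    vdeg (G ⊔ SimpleGraph.edge a b) v =
      vdeg G v + ((if v = a then 1 else 0) + if v = b then 1 else 0) := by
  rw [vdeg_sup, vdeg_edge hab]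
  intro w hw he
  rw [SimpleGraph.edge_adj] at he
  rcases he.1 with ⟨rfl, rfl⟩ | ⟨rfl, rfl⟩
  · exact h hw
  · exact h hw.symm

end Labels

/-! ### Non-increasing sequences: prefix sums and the realization criterion. -/

section Antitone

open Finset in
theorem sum_range_le_of_antitone {D : ℕ → ℕ} (hD : Antitone D) {a b : ℕ} (hab : a ≤ b) {y : ℤ}
    (hy : (D a : ℤ) ≤ y) :
    ((∑ i ∈ range b, D i : ℕ) : ℤ) ≤ (∑ i ∈ range a, D i : ℕ) + ((b : ℤ) - a) * y := by
  induction b, hab using Nat.le_induction with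
  | base => simp
  | succ b hab ih =>
    rw [sum_range_succ]
    have : (D b : ℤ) ≤ D a := by exact_mod_cast hD hab
    push_cast at *
    linarith

open Finset in
theorem le_sum_range {D : ℕ → ℕ} {a b : ℕ} (hab : a ≤ b) {y : ℤ}
    (hy : ∀ i, a ≤ i → i < b → y ≤ D i) :
    ((∑ i ∈ range a, D i : ℕ) : ℤ) + ((b : ℤ) - a) * y ≤ (∑ i ∈ range b, D i : ℕ) := by
  induction b, hab using Nat.le_induction with
  | base => simp
  | succ b hab ih =>
    rw [sum_range_succ]
    have h1 := hy b hab (Nat.lt_succ_self b)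
    have h2 := ih fun i h1 h2 => hy i h1 (h2.trans (Nat.lt_succ_self b))
    push_cast at *
    linarith

variable {n : ℕ}

theorem sum_filter_val_lt (D : ℕ → ℕ) {k : ℕ} (hk : k ≤ n) :
    ∑ v ∈ Finset.univ.filter (fun v : Fin n => v.val < k), D v = ∑ i ∈ Finset.range k, D i := by
  rw [Finset.sum_filter, Fin.sum_univ_eq_sum_range (fun i => if i < k then D i else 0),
    ← Finset.sum_filter]
  congr 1
  ext i
  simp only [Finset.mem_filter, Finset.mem_range]
  omega

theorem card_filter_val_lt {k : ℕ} (hk : k ≤ n) :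
    (Finset.univ.filter (fun v : Fin n => v.val < k)).card = k := by
  have := sum_filter_val_lt (n := n) (fun _ => 1) hk
  simpa using this

theorem sum_filter_val_lt_compl (D : ℕ → ℕ) {k : ℕ} (hk : k ≤ n) :
    ∑ i ∈ Finset.range k, D i + ∑ v ∈ (Finset.univ.filter (fun v : Fin n => v.val < k))ᶜ, D v =
      ∑ i ∈ Finset.range n, D i := by
  rw [← sum_filter_val_lt D hk, Finset.sum_add_sum_compl, Fin.sum_univ_eq_sum_range]

theorem two_mul_sum_range_le {D : ℕ → ℕ} {G : SimpleGraph (Fin n)}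
    (hG : ∀ v : Fin n, vdeg G v = D v) {k : ℕ} (hk : k ≤ n) :
    2 * ∑ i ∈ Finset.range k, D i ≤ k * (k - 1) + ∑ i ∈ Finset.range n, D i := by
  have h := sum_vdeg_le G (Finset.univ.filter (fun v : Fin n => v.val < k))
  rw [card_filter_val_lt hk, Finset.sum_congr rfl fun v _ => hG v, sum_filter_val_lt D hk,
    Finset.sum_congr rfl fun v _ => hG v] at h
  have := sum_filter_val_lt_compl D hk
  omega

/-- A sufficient condition for a non-increasing sequence `D` to have a realization in which the
first `r + 1` vertices form a clique minus the edges of `E`, where `E` is part of a copy of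
`H`. -/
theorem exists_isCliqueMinus_of_antitone {L : Type*} {H : SimpleGraph L} {D : ℕ → ℕ}
    (hD : Antitone D) {r m q ε : ℕ} (hrn : r + 1 < n) (he : Even (∑ i ∈ Finset.range n, D i))
    (hm : D r = m) (hqn : r + q < n) (p : L ↪ Fin n) (E : SimpleGraph (Fin n)) (e : ℕ → ℕ)
    (hEH : ∀ a b, E.Adj a b → ∃ i j, p i = a ∧ p j = b ∧ H.Adj i j)
    (hEr : ∀ a b, E.Adj a b → a.val ≤ r) (hEe : ∀ v : Fin n, vdeg E v = e v)
    (hEs : ∑ v, vdeg E v = ε) (hq : ∀ i, r < i → i ≤ r + q → D i = m)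
    (hlow : ∀ i ≤ r, r ≤ D i + e i) (hup : ∀ i ≤ r, D i + e i ≤ r + q)
    (hs : 2 * ∑ i ∈ Finset.range (r + 1), D i + ε ≤ r * (r + 1) + ∑ i ∈ Finset.range n, D i)
    (hfin : ∀ x N, x ≤ m → (∀ k ≤ n, (∀ i, r < i → i < k → x ≤ D i + 1) → k ≤ N + r + 1) →
      ∑ i ∈ Finset.range (r + 1), D i + ε + 1 ≤ r * (r + 1) + N * (m + 1 - x) → x + 1 ≤ N) :
    ∃ (G : SimpleGraph (Fin n)) (T : Finset (Fin n)) (φ : Fin n → Option L),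
      (∀ v, vdeg G v = D v) ∧ T.card = r + 1 ∧ IsCliqueMinus H G T φ := by
  set T := Finset.univ.filter fun v : Fin n => v.val < r + 1 with hT
  have memT : ∀ v : Fin n, v ∈ T ↔ v.val ≤ r := fun v => by
    simp only [hT, Finset.mem_filter, Finset.mem_univ, true_and, Nat.lt_succ_iff]
  have hcount : ∀ (P : ℕ → Prop) [DecidablePred P] (k : ℕ), k ≤ n → (∀ i, r < i → i < k → P (D i)) →
      k ≤ (Tᶜ.filter fun v : Fin n => P (D v)).card + r + 1 := by
    intro P _ k hk hP
    have h1 : ((Finset.Ico (r + 1) k).attachFin fun i hi =>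
        (Finset.mem_Ico.1 hi).2.trans_le hk) ⊆ Tᶜ.filter fun v : Fin n => P (D v) := by
      intro v hv
      rw [Finset.mem_attachFin, Finset.mem_Ico] at hv
      rw [Finset.mem_filter, Finset.mem_compl, memT]
      exact ⟨by omega, hP v (by omega) hv.2⟩
    have := Finset.card_le_card h1
    rw [Finset.card_attachFin, Nat.card_Ico] at this
    omega
  have hET : ∑ v ∈ T, vdeg E v = ε := by
    rw [← hEs]
    refine Finset.sum_subset (Finset.subset_univ T) fun v _ hv => ?_
    exact vdeg_eq_zero.2 fun w hw => hv ((memT v).2 (hEr v w hw))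
  have hsT : ∑ t ∈ T, (D t + vdeg E t) = ∑ i ∈ Finset.range (r + 1), D i + ε := by
    rw [Finset.sum_add_distrib, hET, sum_filter_val_lt D (by omega)]
  have hsO := sum_filter_val_lt_compl (n := n) D (k := r + 1) (by omega)
  rw [← hT] at hsO
  have hqT : q ≤ (Tᶜ.filter fun v : Fin n => D v = m).card := by
    have := hcount (fun y => y = m) (r + q + 1) (by omega) fun i h1 h2 => hq i h1 (by omega)
    omega
  obtain ⟨G, hG, hadj⟩ := exists_vdeg_eq_cliqueWithout (fun v : Fin n => D v) T E r m
    (card_filter_val_lt (by omega)) (fun a b h => (memT a).2 (hEr a b h))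
    (fun t ht => by rw [hEe]; exact hlow t ((memT t).1 ht))
    (fun t ht => by
      have := hup t ((memT t).1 ht)
      rw [hEe]
      omega)
    (fun v hv => by
      rw [Finset.mem_compl, memT] at hv
      rw [← hm]
      exact hD (by omega))
    (by rw [hsT]; omega)
    (by rw [Fin.sum_univ_eq_sum_range]; exact he)
    ⟨⟨r + 1, hrn⟩, by rw [Finset.mem_compl, memT]; simp⟩
    (fun x N hx hN h => by
      rw [hsT] at h
      refine hfin x N hx (fun k hk hki => ?_) h
      have := hcount (fun y => x ≤ y + 1) k hk hki
      omega)
  obtain ⟨φ, hφ⟩ := exists_isCliqueMinus_of_embedding p hEH hadj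
  exact ⟨G, T, φ, hG, card_filter_val_lt (by omega), hφ⟩

end Antitone

/-! ### Missing edges given by explicit lists. -/

section EdgeLists

/-- The graph whose edges are the images under `p` of the pairs in the list `l`. -/
def edgesOf {L V : Type*} (p : L ↪ V) : List (L × L) → SimpleGraph V
  | [] => ⊥
  | x :: l => edgesOf p l ⊔ SimpleGraph.edge (p x.1) (p x.2)

theorem edgesOf_adj {L V : Type*} {p : L ↪ V} {l : List (L × L)} {a b : V}
    (h : (edgesOf p l).Adj a b) :
    ∃ x ∈ l, (p x.1 = a ∧ p x.2 = b) ∨ (p x.1 = b ∧ p x.2 = a) := by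
  induction l with
  | nil => exact absurd h (by simp [edgesOf])
  | cons x l ih =>
    rcases h with h | h
    · obtain ⟨y, hy, h⟩ := ih h
      exact ⟨y, List.mem_cons_of_mem _ hy, h⟩
    · rw [SimpleGraph.edge_adj] at h
      refine ⟨x, List.mem_cons_self, ?_⟩
      rcases h.1 with ⟨h1, h2⟩ | ⟨h1, h2⟩
      · exact Or.inl ⟨h1.symm, h2.symm⟩
      · exact Or.inr ⟨h2.symm, h1.symm⟩

theorem vdeg_edgesOf {L V : Type*} [Fintype V] [DecidableEq V] (p : L ↪ V) (l : List (L × L))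
    (hne : ∀ x ∈ l, x.1 ≠ x.2)
    (hp : l.Pairwise fun x y => ¬ (y.1 = x.1 ∧ y.2 = x.2) ∧ ¬ (y.1 = x.2 ∧ y.2 = x.1)) (v : V) :
    vdeg (edgesOf p l) v =
      (l.map fun x => (if v = p x.1 then 1 else 0) + if v = p x.2 then 1 else 0).sum := by
  induction l with
  | nil => exact vdeg_bot v
  | cons x l ih =>
    rw [List.pairwise_cons] at hp
    rw [edgesOf, vdeg_sup_edge, ih (fun y hy => hne y (List.mem_cons_of_mem _ hy)) hp.2,
      List.map_cons, List.sum_cons, add_comm]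
    · exact p.injective.ne (hne x List.mem_cons_self)
    · intro h
      obtain ⟨y, hy, h⟩ := edgesOf_adj h
      have := hp.1 y hy
      rcases h with h | h
      · exact this.1 ⟨p.injective h.1, p.injective h.2⟩
      · exact this.2 ⟨p.injective h.1, p.injective h.2⟩

theorem sum_vdeg_edgesOf {L V : Type*} [Fintype V] [DecidableEq V] (p : L ↪ V)
    (l : List (L × L)) (hne : ∀ x ∈ l, x.1 ≠ x.2)
    (hp : l.Pairwise fun x y => ¬ (y.1 = x.1 ∧ y.2 = x.2) ∧ ¬ (y.1 = x.2 ∧ y.2 = x.1)) :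
    ∑ v, vdeg (edgesOf p l) v = 2 * l.length := by
  rw [Finset.sum_congr rfl fun v _ => vdeg_edgesOf p l hne hp v]
  clear hne hp
  induction l with
  | nil => simp
  | cons x l ih =>
    simp only [List.map_cons, List.sum_cons, Finset.sum_add_distrib, ih, List.length_cons]
    simp
    ring

instance : DecidableRel (SimpleGraph.pathGraph 4).Adj := fun _ _ =>
  decidable_of_iff _ SimpleGraph.pathGraph_adj.symm

instance : DecidableRel K3unionP3.Adj := fun a b => by
  unfold K3unionP3
  rcases a with a | a <;> rcases b with b | b <;> simp <;> infer_instance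

/-- The graph whose edges are the pairs in `l`, when the label `x` is put at the place
`r + c x - 4`, can be taken for the missing edges. -/
theorem exists_isCliqueMinus_of_list {n : ℕ} {D : ℕ → ℕ} (hD : Antitone D) {r m q : ℕ}
    (hrn : r + 4 ≤ n) (he : Even (∑ i ∈ Finset.range n, D i)) (hm : D r = m) (hqn : r + q < n)
    (c : Fin 3 ⊕ Fin 4 → ℕ) (hc : Function.Injective c) (hc4 : ∀ x, 4 ≤ r + c x)
    (hc7 : ∀ x, c x ≤ 7) (l : List ((Fin 3 ⊕ Fin 4) × (Fin 3 ⊕ Fin 4)))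
    (hl : ∀ x ∈ l, K3unionP3.Adj x.1 x.2 ∧ c x.1 ≤ 4 ∧ c x.2 ≤ 4)
    (hp : l.Pairwise fun x y => ¬ (y.1 = x.1 ∧ y.2 = x.2) ∧ ¬ (y.1 = x.2 ∧ y.2 = x.1))
    (hq : ∀ i, r < i → i ≤ r + q → D i = m)
    (hlow : ∀ i ≤ r, r ≤ D i + (l.map fun x => (if i = r + c x.1 - 4 then 1 else 0) +
      if i = r + c x.2 - 4 then 1 else 0).sum)
    (hup : ∀ i ≤ r, D i + (l.map fun x => (if i = r + c x.1 - 4 then 1 else 0) +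
      if i = r + c x.2 - 4 then 1 else 0).sum ≤ r + q)
    (hs : 2 * ∑ i ∈ Finset.range (r + 1), D i + 2 * l.length ≤
      r * (r + 1) + ∑ i ∈ Finset.range n, D i)
    (hfin : ∀ x N, x ≤ m → (∀ k ≤ n, (∀ i, r < i → i < k → x ≤ D i + 1) → k ≤ N + r + 1) →
      ∑ i ∈ Finset.range (r + 1), D i + 2 * l.length + 1 ≤ r * (r + 1) + N * (m + 1 - x) →
      x + 1 ≤ N) :
    ∃ (G : SimpleGraph (Fin n)) (T : Finset (Fin n)) (φ : Fin n → Option (Fin 3 ⊕ Fin 4)),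
      (∀ v, vdeg G v = D v) ∧ T.card = r + 1 ∧ IsCliqueMinus K3unionP3 G T φ := by
  -- Values 0 to 4 of `c` are the positions r - 4, ..., r at the end of the clique; 5 to 7 lie
  -- beyond it and hold labels that no listed edge uses. For r = 3 the value 0 is excluded by `hc4`,
  -- which keeps the truncated subtraction exact.
  let p : Fin 3 ⊕ Fin 4 ↪ Fin n :=
    ⟨fun x => ⟨r + c x - 4, by have := hc4 x; have := hc7 x; omega⟩, fun x y h => hc (by
      have h := congrArg Fin.val h
      have := hc4 x
      have := hc4 y
      simp only at h
      omega)⟩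
  have hpv : ∀ x, (p x).val = r + c x - 4 := fun _ => rfl
  have hne : ∀ x ∈ l, x.1 ≠ x.2 := fun x hx => (hl x hx).1.ne
  refine exists_isCliqueMinus_of_antitone hD (by omega) he hm hqn p (edgesOf p l) _ ?_ ?_ ?_
    (sum_vdeg_edgesOf p l hne hp) hq hlow hup hs hfin
  · intro a b hab
    obtain ⟨x, hx, h | h⟩ := edgesOf_adj hab
    · exact ⟨x.1, x.2, h.1, h.2, (hl x hx).1⟩
    · exact ⟨x.2, x.1, h.2, h.1, (hl x hx).1.symm⟩
  · intro a b hab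
    obtain ⟨x, hx, h | h⟩ := edgesOf_adj hab
    · have := (hl x hx).2.1
      rw [← h.1, hpv]
      omega
    · have := (hl x hx).2.2
      rw [← h.2, hpv]
      omega
  · intro v
    rw [vdeg_edgesOf p l hne hp]
    simp only [Fin.ext_iff, hpv]

end EdgeLists

/-! ### Flat sequences, and the case without deficient vertices. -/

section Flat

/-- A non-increasing sequence with the numerical properties of a graphic sequence of large sum,
whose terms are constant from the `r`-th one to the `D 0 + 1`-st one (counted from zero). The
partial sums are `P`. -/
structure FlatSequence (n r : ℕ) (D : ℕ → ℕ) (P : ℕ → ℤ) : Prop where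
  three_le : 3 ≤ r
  le_n : 5 * r + 18 ≤ n
  le_n' : r + 42 ≤ n
  anti : Antitone D
  even : Even (∑ i ∈ Finset.range n, D i)
  P_eq : ∀ k, P k = (∑ i ∈ Finset.range k, D i : ℕ)
  erdosGallai : ∀ k ≤ n, 2 * P k ≤ (k : ℤ) * (k - 1) + P n
  le_P : (2 * (r : ℤ) - 5) * n - r ^ 2 + 4 * r ≤ P n + 1
  flat : D r ≤ D (D 0 + 1)
  lt_n : D 0 + 1 < n
  four_le_or : 4 ≤ r ∨ D 0 ≤ 2

/-- The conclusion sought for the sequence `D`. -/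
def HasNearClique (n r : ℕ) (D : ℕ → ℕ) : Prop :=
  ∃ (G : SimpleGraph (Fin n)) (T : Finset (Fin n)) (φ : Fin n → Option (Fin 3 ⊕ Fin 4)),
    (∀ v, vdeg G v = D v) ∧ T.card = r + 1 ∧ IsCliqueMinus K3unionP3 G T φ

namespace FlatSequence

variable {n r : ℕ} {D : ℕ → ℕ} {P : ℕ → ℤ}

theorem P_zero (h : FlatSequence n r D P) : P 0 = 0 := by simp [h.P_eq]

theorem P_le (h : FlatSequence n r D P) {a b : ℕ} (hab : a ≤ b) (y : ℤ) (hy : (D a : ℤ) ≤ y) :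
    P b ≤ P a + ((b : ℤ) - a) * y := by
  rw [h.P_eq, h.P_eq]
  exact sum_range_le_of_antitone h.anti hab hy

theorem le_P_of (h : FlatSequence n r D P) {a b : ℕ} (hab : a ≤ b) {y : ℤ} (hy : ∀ i, a ≤ i → i < b → y ≤ D i) :
    P a + ((b : ℤ) - a) * y ≤ P b := by
  rw [h.P_eq, h.P_eq]
  exact le_sum_range hab hy

theorem eq_of_le (h : FlatSequence n r D P) {i : ℕ} (h1 : r ≤ i) (h2 : i ≤ D 0 + 1) : D i = D r :=
  le_antisymm (h.anti h1) (h.flat.trans (h.anti h2))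

/-- Otherwise the terms after the first r + 1 are at most r - 3, and Erdős–Gallai at r + 1 bounds
the sum by (2r - 6)n plus lower terms, below the threshold. -/
theorem le_succ (h : FlatSequence n r D P) : r - 2 ≤ D (r + 1) := by
  have := h.le_n
  have := h.le_n'
  have := h.three_le
  by_contra hlt
  have h1 := h.erdosGallai (r + 1) (by omega)
  have h2 := h.P_le (show r + 1 ≤ n by omega) ((r : ℤ) - 3) (by omega)
  have h3 := h.le_P
  push_cast at h1 h2
  nlinarith

theorem exists_of_list (h : FlatSequence n r D P) {q : ℕ} (hqn : r + q < n) (c : Fin 3 ⊕ Fin 4 → ℕ)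
    (hc : Function.Injective c) (hc4 : ∀ x, 4 ≤ r + c x)
    (hc7 : ∀ x, c x ≤ 7) (l : List ((Fin 3 ⊕ Fin 4) × (Fin 3 ⊕ Fin 4)))
    (hl : ∀ x ∈ l, K3unionP3.Adj x.1 x.2 ∧ c x.1 ≤ 4 ∧ c x.2 ≤ 4)
    (hp : l.Pairwise fun x y => ¬ (y.1 = x.1 ∧ y.2 = x.2) ∧ ¬ (y.1 = x.2 ∧ y.2 = x.1))
    (hq : ∀ i, r < i → i ≤ r + q → D i = D r)
    (hlow : ∀ i ≤ r, r ≤ D i + (l.map fun x => (if i = r + c x.1 - 4 then 1 else 0) +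
      if i = r + c x.2 - 4 then 1 else 0).sum)
    (hup : ∀ i ≤ r, D i + (l.map fun x => (if i = r + c x.1 - 4 then 1 else 0) +
      if i = r + c x.2 - 4 then 1 else 0).sum ≤ r + q)
    (hs : 2 * P (r + 1) + 2 * l.length ≤ r * (r + 1) + P n)
    (hfin : ∀ x N, x ≤ D r → (∀ k ≤ n, (∀ i, r < i → i < k → x ≤ D i + 1) → k ≤ N + r + 1) →
      P (r + 1) + 2 * l.length + 1 ≤ r * (r + 1) + N * (D r + 1 - x) → x + 1 ≤ N) :
    HasNearClique n r D := by
  have := h.le_n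
  refine exists_isCliqueMinus_of_list h.anti (by omega) h.even rfl hqn c hc hc4 hc7 l hl hp hq
    hlow hup ?_ fun x N hx hN hsum => hfin x N hx hN ?_
  · rw [h.P_eq, h.P_eq] at hs
    exact_mod_cast hs
  · rw [h.P_eq]
    zify [show x ≤ D r + 1 by omega] at hsum ⊢
    exact hsum

/-- All of the first r + 1 degrees are at least r, so a full clique is built. -/
theorem hasNearClique_of_le (h : FlatSequence n r D P) (hrm : r ≤ D r) : HasNearClique n r D := by
  have hn := h.le_n
  have hn' := h.le_n'
  have hlt := h.lt_n
  have hS := h.le_P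
  have hD0 := h.anti (Nat.zero_le r)
  have hr4 : 4 ≤ r := by
    have := h.four_le_or
    have := h.three_le
    omega
  have hN : r - 1 ≤ D (2 * r + 1) := by
    by_contra hlt'
    by_cases hD0 : 2 * r ≤ D 0
    · have := h.anti (show 2 * r + 1 ≤ D 0 + 1 by omega)
      have := h.flat
      omega
    have h1 := h.P_le (show 0 ≤ 2 * r + 1 by omega) (2 * (r : ℤ) - 1) (by omega)
    have h2 := h.P_le (show 2 * r + 1 ≤ n by omega) ((r : ℤ) - 2) (by omega)
    rw [h.P_zero] at h1
    -- For r = 4 the estimate is tight: at n = 46 both bounds on the sum equal 137, and only parity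
    -- excludes it. This uses n ≥ r + 42.
    rcases hr4.eq_or_lt with rfl | hr5
    · have he := h.even
      have h3 := h.P_eq n
      rw [Nat.even_iff] at he
      push_cast at h1 h2 hS
      norm_num at h1 h2 hS
      omega
    · push_cast at h1 h2
      have h5 : (0 : ℤ) ≤ (r - 3) * (n - (5 * r + 18)) := mul_nonneg (by omega) (by omega)
      have h6 : (0 : ℤ) ≤ (r - 5) * r := mul_nonneg (by omega) (by omega)
      nlinarith
  refine h.exists_of_list (q := D 0 + 1 - r) (by omega) (Sum.elim ![0, 1, 2] ![3, 4, 5, 6])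
    (by decide) (fun _ => by omega) (by decide) [] (by simp) (by simp)
    (fun i h1 h2 => h.eq_of_le h1.le (by omega)) ?_ ?_ ?_ ?_
  · intro i hi
    have := h.anti hi
    simp only [List.map_nil, List.sum_nil]
    omega
  · intro i hi
    have := h.anti (Nat.zero_le i)
    simp only [List.map_nil, List.sum_nil]
    omega
  · have h1 := h.erdosGallai (r + 1) (by omega)
    simp only [List.length_nil]
    push_cast at h1 ⊢
    linarith
  · intro x N hx hN' hsum
    have h1 := hN' (D 0 + 2) (by omega) (fun i h1 h2 => by
      have := h.eq_of_le h1.le (by omega)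
      omega)
    by_cases hxr : x ≤ r
    · have h2 := hN' (2 * r + 2) (by omega) (fun i h1 h2 => by
        have := h.anti (show i ≤ 2 * r + 1 by omega)
        omega)
      omega
    · by_contra hxN
      have h2 := h.le_P_of (show 0 ≤ r + 1 by omega) (y := D r) (fun i _ hi => by
        have := h.anti (show i ≤ r by omega)
        omega)
      rw [h.P_zero] at h2
      -- Now x > r. If N ≤ x, then `h1` gives z ≤ r, and (x - r - 1)(r - z) ≥ 0 contradicts `hsum`
      -- together with P (r + 1) ≥ (r + 1) D r.
      obtain ⟨z, hz⟩ : ∃ z : ℤ, (D r : ℤ) = x + z - 1 := ⟨D r + 1 - x, by ring⟩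
      have h3 : (N : ℤ) * z ≤ x * z := mul_le_mul_of_nonneg_right (by omega) (by omega)
      rw [hz] at h2 hsum
      simp only [List.length_nil] at hsum
      push_cast at h2 hsum
      have h4 : (0 : ℤ) ≤ (x - r - 1) * (r - z) := mul_nonneg (by omega) (by omega)
      nlinarith

end FlatSequence

end Flat

/-! ### Flat sequences with D r = r - 1 or r - 2. -/

section FlatCases

namespace FlatSequence

variable {n r : ℕ} {D : ℕ → ℕ} {P : ℕ → ℤ}

/-- A large `D 0` yields this by flatness; a small one makes the whole sum too small. It supplies
the r vertices outside the clique needed to realize the remaining demands. -/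
theorem le_two_mul (h : FlatSequence n r D P) (hm : D r + 1 = r) : r - 2 ≤ D (2 * r) := by
  have hn := h.le_n
  have hr := h.three_le
  have hS := h.le_P
  have hf := h.flat
  by_contra hlt'
  by_cases hD0 : 2 * r ≤ D 0 + 1
  · have := h.anti hD0
    omega
  have h1 := h.P_le (show 0 ≤ 2 * r by omega) (2 * (r : ℤ) - 2) (by omega)
  have h2 := h.P_le (show 2 * r ≤ n by omega) ((r : ℤ) - 3) (by omega)
  rw [h.P_zero] at h1
  push_cast at h1 h2
  have h5 : (0 : ℤ) ≤ (r - 2) * (n - (5 * r + 18)) := mul_nonneg (by omega) (by omega)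
  have h6 : (0 : ℤ) ≤ (r - 3) * r := mul_nonneg (by omega) (by omega)
  nlinarith

theorem le_two_mul_sub_one (h : FlatSequence n r D P) (hm : D r + 2 = r) :
    r - 3 ≤ D (2 * r - 1) := by
  have hn := h.le_n
  have hr := h.three_le
  have hS := h.le_P
  have hf := h.flat
  by_contra hlt'
  by_cases hD0 : 2 * r ≤ D 0 + 2
  · have := h.anti (show 2 * r - 1 ≤ D 0 + 1 by omega)
    omega
  have h1 := h.P_le (show 0 ≤ 2 * r - 1 by omega) (2 * (r : ℤ) - 3) (by omega)
  have h2 := h.P_le (show 2 * r - 1 ≤ n by omega) ((r : ℤ) - 4) (by omega)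
  rw [h.P_zero] at h1
  rw [Nat.cast_sub (by omega)] at h1 h2
  push_cast at h1 h2
  have h5 : (0 : ℤ) ≤ (r - 1) * (n - (5 * r + 18)) := mul_nonneg (by omega) (by omega)
  have h6 : (0 : ℤ) ≤ (r - 3) * r := mul_nonneg (by omega) (by omega)
  nlinarith

theorem count_of_add_one_eq (h : FlatSequence n r D P) (hm : D r + 1 = r) {x N : ℕ}
    (hx : x ≤ D r) (hN : ∀ k ≤ n, (∀ i, r < i → i < k → x ≤ D i + 1) → k ≤ N + r + 1) :
    x + 1 ≤ N := by
  have hn := h.le_n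
  have h1 := h.le_two_mul hm
  have h2 := hN (2 * r + 1) (by omega) (fun i _ hi => by
    have := h.anti (show i ≤ 2 * r by omega)
    omega)
  omega

theorem count_of_add_two_eq (h : FlatSequence n r D P) (hm : D r + 2 = r) {x N : ℕ}
    (hx : x ≤ D r) (hN : ∀ k ≤ n, (∀ i, r < i → i < k → x ≤ D i + 1) → k ≤ N + r + 1) :
    x + 1 ≤ N := by
  have hn := h.le_n
  have h1 := h.le_two_mul_sub_one hm
  have h2 := hN (2 * r) (by omega) (fun i _ hi => by
    have := h.anti (show i ≤ 2 * r - 1 by omega)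
    omega)
  omega

/-- Exactly the positions r - 4, ..., r have deficiency 1, and a triangle plus an edge covers five
vertices. -/
theorem hasNearClique_triangle_edge (h : FlatSequence n r D P) (hm : D r + 1 = r) (hr4 : 4 ≤ r)
    (hA : D (r - 4) ≤ r - 1) : HasNearClique n r D := by
  have hn := h.le_n
  have hlt := h.lt_n
  have hS := h.le_P
  have hr1 : D (r + 1) = D r := by
    have := h.le_succ
    have := h.anti (show r ≤ r + 1 by omega)
    by_contra hne
    have h1 := h.P_le (show 0 ≤ r - 4 by omega) ((n : ℤ) - 1) (by omega)
    have h2 := h.P_le (show r - 4 ≤ r + 1 by omega) ((r : ℤ) - 1) (by omega)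
    have h3 := h.P_le (show r + 1 ≤ n by omega) ((r : ℤ) - 2) (by omega)
    rw [h.P_zero] at h1
    push_cast [hr4] at h1 h2 h3
    nlinarith
  have hr5 : 5 ≤ r → r ≤ D (r - 5) := by
    intro hr5
    by_contra hne
    have h1 := h.P_le (show 0 ≤ r - 5 by omega) ((n : ℤ) - 1) (by omega)
    have h2 := h.P_le (show r - 5 ≤ n by omega) ((r : ℤ) - 1) (by omega)
    rw [h.P_zero] at h1
    push_cast [hr5] at h1 h2
    nlinarith
  -- `D 0` may be only r - 1, while a triangle vertex has demand (r - 1) + 2 = r + 1, so q ≥ 1 is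
  -- needed.
  obtain ⟨q, hq⟩ : ∃ q, q = max 1 (D 0 + 1 - r) := ⟨_, rfl⟩
  have hqD : ∀ i, r < i → i ≤ r + q → D i = D r := fun i h1 h2 => by
    rcases (show i = r + 1 ∨ i ≤ D 0 + 1 by omega) with rfl | h3
    · exact hr1
    · exact h.eq_of_le h1.le h3
  refine h.exists_of_list (q := q) (by omega) (Sum.elim ![0, 1, 2] ![3, 4, 5, 6]) (by decide)
    (fun _ => by omega) (by decide)
    [(.inl 0, .inl 1), (.inl 1, .inl 2), (.inl 0, .inl 2), (.inr 0, .inr 1)]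
    (by decide) (by decide) hqD ?_ ?_ ?_ (fun x N hx hN _ => h.count_of_add_one_eq hm hx hN)
  · intro i hi
    have h1 := h.anti hi
    have h2 : i + 5 ≤ r → r ≤ D i := fun hi =>
      (hr5 (by omega)).trans (h.anti (show i ≤ r - 5 by omega))
    simp
    split_ifs <;> omega
  · intro i hi
    have h1 := h.anti (Nat.zero_le i)
    have h2 : r ≤ i + 4 → D i ≤ r - 1 := fun hi =>
      (h.anti (show r - 4 ≤ i by omega)).trans hA
    simp
    split_ifs <;> omega
  · have h1 := h.P_le (show 0 ≤ r - 4 by omega) (D 0) le_rfl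
    have h2 := h.P_le (show r - 4 ≤ r + 1 by omega) ((r : ℤ) - 1) (by omega)
    have h3 := h.le_P_of (show r + 1 ≤ r + 1 + q by omega) (y := r - 1) (fun i h1 h2 => by
      rw [hqD i (by omega) (by omega)]
      omega)
    have h4 := h.le_P_of (show r + 1 + q ≤ n by omega) (y := 0) (fun i _ _ => by omega)
    rw [h.P_zero] at h1
    have h5 : (0 : ℤ) ≤ (r - 4) * (q - (D 0 - r)) := mul_nonneg (by omega) (by omega)
    have h6 : (1 : ℤ) ≤ q := by omega
    push_cast [hr4] at h1 h2 h3 h4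
    simp only [List.length_cons, List.length_nil]
    push_cast
    nlinarith

/-- The deficient positions lie among r - 3, ..., r, which two disjoint edges cover. -/
theorem hasNearClique_two_edges (h : FlatSequence n r D P) (hm : D r + 1 = r)
    (hA : 4 ≤ r → r ≤ D (r - 4)) (hB : D (r - 1) ≤ r - 1) : HasNearClique n r D := by
  have hn := h.le_n
  have hlt := h.lt_n
  have hr := h.three_le
  have hD0 := h.anti (Nat.zero_le r)
  refine h.exists_of_list (q := D 0 + 1 - r) (by omega) (Sum.elim ![1, 2, 5] ![3, 4, 6, 7])
    (by decide) (by rintro (x | x) <;> fin_cases x <;> simp <;> omega) (by decide)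
    [(.inl 0, .inl 1), (.inr 0, .inr 1)]
    (by decide) (by decide) (fun i h1 h2 => h.eq_of_le h1.le (by omega)) ?_ ?_ ?_
    (fun x N hx hN _ => h.count_of_add_one_eq hm hx hN)
  · intro i hi
    have h1 := h.anti hi
    have h2 : i + 4 ≤ r → r ≤ D i := fun hi =>
      (hA (by omega)).trans (h.anti (show i ≤ r - 4 by omega))
    simp
    split_ifs <;> omega
  · intro i hi
    have h1 := h.anti (Nat.zero_le i)
    simp
    split_ifs <;> omega
  · have h1 := h.P_le (show 0 ≤ r - 1 by omega) (D 0) le_rfl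
    have h2 := h.P_le (show r - 1 ≤ r + 1 by omega) ((r : ℤ) - 1) (by omega)
    have h3 := h.le_P_of (show r + 1 ≤ D 0 + 2 by omega) (y := r - 1) (fun i h1 h2 => by
      rw [h.eq_of_le (by omega) (by omega)]
      omega)
    have h4 := h.le_P_of (show D 0 + 2 ≤ n by omega) (y := 0) (fun i _ _ => by omega)
    rw [h.P_zero] at h1
    push_cast [show 1 ≤ r by omega] at h1 h2 h3 h4
    simp only [List.length_cons, List.length_nil]
    push_cast
    nlinarith

/-- Only position r is deficient. Erdős–Gallai at r, instead of r + 1, has exactly the slack 2 that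
one missing edge costs. -/
theorem hasNearClique_edge (h : FlatSequence n r D P) (hm : D r + 1 = r)
    (hB : r ≤ D (r - 1)) : HasNearClique n r D := by
  have hn := h.le_n
  have hlt := h.lt_n
  have hr := h.three_le
  have hD0 := h.anti (Nat.zero_le r)
  refine h.exists_of_list (q := D 0 + 1 - r) (by omega) (Sum.elim ![3, 4, 5] ![1, 2, 6, 7])
    (by decide) (by rintro (x | x) <;> fin_cases x <;> simp <;> omega) (by decide)
    [(.inl 0, .inl 1)]
    (by decide) (by decide) (fun i h1 h2 => h.eq_of_le h1.le (by omega)) ?_ ?_ ?_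
    (fun x N hx hN _ => h.count_of_add_one_eq hm hx hN)
  · intro i hi
    have h1 := h.anti hi
    have h2 : i + 1 ≤ r → r ≤ D i := fun hi => hB.trans (h.anti (show i ≤ r - 1 by omega))
    simp
    split_ifs <;> omega
  · intro i hi
    have h1 := h.anti (Nat.zero_le i)
    simp
    split_ifs <;> omega
  · have h1 := h.erdosGallai r (by omega)
    have h2 := h.P_le (show r ≤ r + 1 by omega) ((r : ℤ) - 1) (by omega)
    push_cast at h2
    simp only [List.length_cons, List.length_nil]
    push_cast
    nlinarith

/-- Positions r - 2, r - 1, r have deficiency 2 each: omit the triangle on them. -/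
theorem hasNearClique_triangle (h : FlatSequence n r D P) (hm : D r + 2 = r)
    (hA : D (r - 2) ≤ r - 2) : HasNearClique n r D := by
  have hn := h.le_n
  have hn' := h.le_n'
  have hlt := h.lt_n
  have hr := h.three_le
  have hS := h.le_P
  have hr1 : D (r + 1) = D r := by
    have := h.le_succ
    have := h.anti (show r ≤ r + 1 by omega)
    omega
  -- The upper bound and the threshold have the same coefficient of n here, so the lower-order terms
  -- decide.
  have hB : r ≤ D (r - 3) := by
    by_contra hne
    have h1 := h.P_le (show 0 ≤ r - 3 by omega) ((n : ℤ) - 2) (by omega)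
    have h2 := h.P_le (show r - 3 ≤ r - 2 by omega) ((r : ℤ) - 1) (by omega)
    have h3 := h.P_le (show r - 2 ≤ n by omega) ((r : ℤ) - 2) (by omega)
    rw [h.P_zero] at h1
    push_cast [hr, show 2 ≤ r by omega] at h1 h2 h3
    nlinarith
  obtain ⟨q, hq⟩ : ∃ q, q = max 1 (D 0 + 1 - r) := ⟨_, rfl⟩
  have hqD : ∀ i, r < i → i ≤ r + q → D i = D r := fun i h1 h2 => by
    rcases (show i = r + 1 ∨ i ≤ D 0 + 1 by omega) with rfl | h3
    · exact hr1
    · exact h.eq_of_le h1.le h3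
  refine h.exists_of_list (q := q) (by omega) (Sum.elim ![2, 3, 4] ![1, 5, 6, 7]) (by decide)
    (by rintro (x | x) <;> fin_cases x <;> simp <;> omega) (by decide)
    [(.inl 0, .inl 1), (.inl 1, .inl 2), (.inl 0, .inl 2)]
    (by decide) (by decide) hqD ?_ ?_ ?_ (fun x N hx hN _ => h.count_of_add_two_eq hm hx hN)
  · intro i hi
    have h1 := h.anti hi
    have h2 : i + 3 ≤ r → r ≤ D i := fun hi => hB.trans (h.anti (show i ≤ r - 3 by omega))
    simp
    split_ifs <;> omega
  · intro i hi
    have h1 := h.anti (Nat.zero_le i)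
    have h2 : r ≤ i + 2 → D i ≤ r - 2 := fun hi =>
      (h.anti (show r - 2 ≤ i by omega)).trans hA
    simp
    split_ifs <;> omega
  · have h1 := h.P_le (show 0 ≤ r - 2 by omega) (D 0) le_rfl
    have h2 := h.P_le (show r - 2 ≤ r + 1 by omega) ((r : ℤ) - 2) (by omega)
    have h3 := h.le_P_of (show r + 1 ≤ r + 1 + q by omega) (y := r - 2) (fun i h1 h2 => by
      rw [hqD i (by omega) (by omega)]
      omega)
    have h4 := h.le_P_of (show r + 1 + q ≤ n by omega) (y := 0) (fun i _ _ => by omega)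
    rw [h.P_zero] at h1
    have h5 : (0 : ℤ) ≤ (r - 2) * (q - (D 0 - r)) := mul_nonneg (by omega) (by omega)
    push_cast [show 2 ≤ r by omega] at h1 h2 h3 h4
    simp only [List.length_cons, List.length_nil]
    push_cast
    nlinarith

theorem le_sub_four (h : FlatSequence n r D P) (hm : D r + 2 = r) (hr4 : 4 ≤ r) :
    r ≤ D (r - 4) := by
  have hn := h.le_n
  have hn' := h.le_n'
  have hlt := h.lt_n
  have hS := h.le_P
  by_contra hne
  have h1 := h.P_le (show 0 ≤ r - 4 by omega) ((n : ℤ) - 1) (by omega)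
  have h2 := h.P_le (show r - 4 ≤ r by omega) ((r : ℤ) - 1) (by omega)
  have h3 := h.P_le (show r ≤ n by omega) ((r : ℤ) - 2) (by omega)
  rw [h.P_zero] at h1
  push_cast [hr4] at h1 h2 h3
  nlinarith

/-- Deficiency is 2 at r, 1 or 2 at r - 1, and at most 1 at r - 2; if r - 3 is deficient by 2, so is
r - 1 no less. The path r - 3, r, r - 1, r - 2 gives the two last positions degree 2. -/
theorem hasNearClique_path (h : FlatSequence n r D P) (hm : D r + 2 = r)
    (hA : r - 1 ≤ D (r - 2)) (hB : D (r - 1) ≤ r - 1)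
    (hC : D (r - 1) ≤ r - 2 ∨ D (r - 3) ≤ r - 1) : HasNearClique n r D := by
  have hn := h.le_n
  have hn' := h.le_n'
  have hlt := h.lt_n
  have hr := h.three_le
  have hr1 : D (r + 1) = D r := by
    have := h.le_succ
    have := h.anti (show r ≤ r + 1 by omega)
    omega
  obtain ⟨q, hq⟩ : ∃ q, q = max 1 (D 0 + 1 - r) := ⟨_, rfl⟩
  have hqD : ∀ i, r < i → i ≤ r + q → D i = D r := fun i h1 h2 => by
    rcases (show i = r + 1 ∨ i ≤ D 0 + 1 by omega) with rfl | h3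
    · exact hr1
    · exact h.eq_of_le h1.le h3
  refine h.exists_of_list (q := q) (by omega) (Sum.elim ![5, 6, 7] ![1, 4, 3, 2]) (by decide)
    (by rintro (x | x) <;> fin_cases x <;> simp <;> omega) (by decide)
    [(.inr 0, .inr 1), (.inr 1, .inr 2), (.inr 2, .inr 3)]
    (by decide) (by decide) hqD ?_ ?_ ?_ (fun x N hx hN _ => h.count_of_add_two_eq hm hx hN)
  · intro i hi
    have h1 := h.anti hi
    have h2 : i + 4 ≤ r → r ≤ D i := fun hi =>
      (h.le_sub_four hm (by omega)).trans (h.anti (show i ≤ r - 4 by omega))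
    have h3 : i + 2 ≤ r → r - 1 ≤ D i := fun hi => hA.trans (h.anti (show i ≤ r - 2 by omega))
    simp
    split_ifs <;> omega
  · intro i hi
    have h1 := h.anti (Nat.zero_le i)
    have h2 : r ≤ i + 1 → D i ≤ r - 1 := fun hi =>
      (h.anti (show r - 1 ≤ i by omega)).trans hB
    have h3 : i = r → D i + 2 = r := fun hi => hi ▸ hm
    simp
    split_ifs <;> omega
  · simp only [List.length_cons, List.length_nil]
    rcases hC with hC | hC
    · have h1 := h.erdosGallai (r - 1) (by omega)
      have h2 := h.P_le (show r - 1 ≤ r + 1 by omega) ((r : ℤ) - 2) (by omega)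
      push_cast [show 1 ≤ r by omega] at h1 h2 ⊢
      nlinarith
    · have h1 := h.P_le (show 0 ≤ r - 3 by omega) (D 0) le_rfl
      have h2 := h.P_le (show r - 3 ≤ r by omega) ((r : ℤ) - 1) (by omega)
      have h2' := h.P_le (show r ≤ r + 1 by omega) ((r : ℤ) - 2) (by omega)
      have h3 := h.le_P_of (show r + 1 ≤ r + 1 + q by omega) (y := r - 2) (fun i h1 h2 => by
        rw [hqD i (by omega) (by omega)]
        omega)
      have h4 := h.le_P_of (show r + 1 + q ≤ n by omega) (y := 0) (fun i _ _ => by omega)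
      rw [h.P_zero] at h1
      have h5 : (0 : ℤ) ≤ (r - 3) * (q - (D 0 - r)) := mul_nonneg (by omega) (by omega)
      have h6 : (1 : ℤ) ≤ q := by omega
      push_cast [hr] at h1 h2 h2' h3 h4 ⊢
      nlinarith

/-- Deficiency is 2 at r, at most 1 at r - 1 and r - 2, and 0 before: the path r - 1, r, r - 2 is
omitted, and Erdős–Gallai at r pays exactly its cost 4. -/
theorem hasNearClique_cherry (h : FlatSequence n r D P) (hm : D r + 2 = r)
    (hA : r ≤ D (r - 3)) (hB : r - 1 ≤ D (r - 1)) : HasNearClique n r D := by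
  have hn := h.le_n
  have hn' := h.le_n'
  have hlt := h.lt_n
  have hr := h.three_le
  have hr1 : D (r + 1) = D r := by
    have := h.le_succ
    have := h.anti (show r ≤ r + 1 by omega)
    omega
  obtain ⟨q, hq⟩ : ∃ q, q = max 1 (D 0 + 1 - r) := ⟨_, rfl⟩
  have hqD : ∀ i, r < i → i ≤ r + q → D i = D r := fun i h1 h2 => by
    rcases (show i = r + 1 ∨ i ≤ D 0 + 1 by omega) with rfl | h3
    · exact hr1
    · exact h.eq_of_le h1.le h3
  refine h.exists_of_list (q := q) (by omega) (Sum.elim ![1, 5, 6] ![3, 4, 2, 7]) (by decide)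
    (by rintro (x | x) <;> fin_cases x <;> simp <;> omega) (by decide)
    [(.inr 0, .inr 1), (.inr 1, .inr 2)]
    (by decide) (by decide) hqD ?_ ?_ ?_ (fun x N hx hN _ => h.count_of_add_two_eq hm hx hN)
  · intro i hi
    have h1 := h.anti hi
    have h2 : i + 3 ≤ r → r ≤ D i := fun hi => hA.trans (h.anti (show i ≤ r - 3 by omega))
    have h3 : i + 1 ≤ r → r - 1 ≤ D i := fun hi => hB.trans (h.anti (show i ≤ r - 1 by omega))
    simp
    split_ifs <;> omega
  · intro i hi
    have h1 := h.anti (Nat.zero_le i)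
    have h3 : i = r → D i + 2 = r := fun hi => hi ▸ hm
    simp
    split_ifs <;> omega
  · simp only [List.length_cons, List.length_nil]
    have h1 := h.erdosGallai r (by omega)
    have h2 := h.P_le (show r ≤ r + 1 by omega) ((r : ℤ) - 2) (by omega)
    push_cast at h1 h2 ⊢
    nlinarith

theorem hasNearClique (h : FlatSequence n r D P) : HasNearClique n r D := by
  have hr := h.three_le
  have h1 := h.le_succ
  have h2 := h.anti (show r ≤ r + 1 by omega)
  rcases (show r ≤ D r ∨ D r + 1 = r ∨ D r + 2 = r by omega) with hm | hm | hm
  · exact h.hasNearClique_of_le hm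
  · by_cases hA : 4 ≤ r ∧ D (r - 4) ≤ r - 1
    · exact h.hasNearClique_triangle_edge hm hA.1 hA.2
    · by_cases hB : D (r - 1) ≤ r - 1
      · exact h.hasNearClique_two_edges hm (by omega) hB
      · exact h.hasNearClique_edge hm (by omega)
  · have h3 := h.anti (show r - 2 ≤ r - 1 by omega)
    by_cases hA : D (r - 2) ≤ r - 2
    · exact h.hasNearClique_triangle hm hA
    · by_cases hB : D (r - 1) ≤ r - 2 ∨ D (r - 3) ≤ r - 1
      · have h4 := h.anti (show r - 3 ≤ r - 1 by omega)
        exact h.hasNearClique_path hm (by omega) (by omega) hB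
      · exact h.hasNearClique_cherry hm (by omega) (by omega)

end FlatSequence

end FlatCases

/-! ### Deleting a vertex of largest degree; the induction on r. -/

section Induction

open scoped Classical

variable {V : Type*}

/-- Add to a graph on the vertices other than `u` the edges of `K` at `u`. -/
def addVertex (K : SimpleGraph V) (u : V) (G : SimpleGraph {v // v ≠ u}) : SimpleGraph V where
  Adj a b := (∃ ha hb, G.Adj ⟨a, ha⟩ ⟨b, hb⟩) ∨ ((a = u ∨ b = u) ∧ K.Adj a b)
  symm := ⟨fun a b h => by
    rcases h with ⟨ha, hb, h⟩ | ⟨h, h'⟩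
    · exact Or.inl ⟨hb, ha, h.symm⟩
    · exact Or.inr ⟨h.symm, h'.symm⟩⟩
  loopless := ⟨fun a h => by
    rcases h with ⟨ha, hb, h⟩ | ⟨h, h'⟩
    · exact G.loopless.irrefl _ h
    · exact K.loopless.irrefl _ h'⟩

theorem addVertex_adj_val {K : SimpleGraph V} {u : V} {G : SimpleGraph {v // v ≠ u}}
    {a b : {v // v ≠ u}} : (addVertex K u G).Adj a b ↔ G.Adj a b := by
  simp [addVertex, a.2, b.2]

theorem addVertex_adj {K : SimpleGraph V} {u : V} {G : SimpleGraph {v // v ≠ u}} {a : V} :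
    (addVertex K u G).Adj a u ↔ K.Adj a u := by
  simp [addVertex]

theorem IsCliqueMinus.comap_equiv {W L : Type*} {H : SimpleGraph L} (e : W ≃ V)
    {G : SimpleGraph V} {T : Finset V} {φ : V → Option L} (h : IsCliqueMinus H G T φ) :
    IsCliqueMinus H (G.comap e) (T.map e.symm.toEmbedding) (fun w => φ (e w)) := by
  have hT : ∀ w ∈ T.map e.symm.toEmbedding, e w ∈ T := fun w hw => by
    obtain ⟨v, hv, rfl⟩ := Finset.mem_map.1 hw
    simpa using hv
  exact ⟨fun a ha b hb h1 h2 => e.injective (h.1 _ (hT a ha) _ (hT b hb) h1 h2),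
    fun a ha b hb hab h' => h.2 _ (hT a ha) _ (hT b hb) (e.injective.ne hab) h'⟩

variable [Fintype V]

theorem vdeg_eq_vdeg_comap_val (K : SimpleGraph V) (u : V) (w : {v // v ≠ u}) :
    vdeg K w = vdeg (K.comap Subtype.val) w + if K.Adj w u then 1 else 0 := by
  rw [vdeg_eq_sum, vdeg_eq_sum, Fintype.sum_eq_add_sum_subtype_ne _ u, add_comm]
  rfl

theorem sum_vdeg_eq_comap_val (K : SimpleGraph V) (u : V) :
    ∑ v, vdeg K v = ∑ w, vdeg (K.comap (Subtype.val : {v // v ≠ u} → V)) w + 2 * vdeg K u := by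
  rw [Fintype.sum_eq_add_sum_subtype_ne _ u,
    Finset.sum_congr rfl fun w _ => vdeg_eq_vdeg_comap_val K u w, Finset.sum_add_distrib]
  have : vdeg K u = ∑ w : {v // v ≠ u}, if K.Adj w u then 1 else 0 := by
    rw [vdeg_eq_sum, Fintype.sum_eq_add_sum_subtype_ne _ u]
    simp [K.adj_comm u]
  omega

theorem vdeg_addVertex {K : SimpleGraph V} {u : V} {G : SimpleGraph {v // v ≠ u}}
    (hG : ∀ w, vdeg G w = vdeg (K.comap Subtype.val) w) (v : V) :
    vdeg (addVertex K u G) v = vdeg K v := by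
  by_cases hv : v = u
  · subst hv
    rw [vdeg_eq_sum, vdeg_eq_sum]
    refine Finset.sum_congr rfl fun w _ => ?_
    rw [SimpleGraph.adj_comm, K.adj_comm]
    simp only [addVertex_adj]
  · have h1 := vdeg_eq_vdeg_comap_val (addVertex K u G) u ⟨v, hv⟩
    have h2 := vdeg_eq_vdeg_comap_val K u ⟨v, hv⟩
    have h3 : (addVertex K u G).comap Subtype.val = G := by
      ext a b
      exact addVertex_adj_val
    rw [h3] at h1
    simp only [addVertex_adj] at h1
    rw [h1, h2, hG]

/-- The triangle of K_3 ∪ P_3 sits on `A`; any four other vertices take the labels of the path. -/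
theorem exists_isCliqueMinus_of_triple {G : SimpleGraph V} {A T : Finset V} (hA : A.card = 3)
    (hV : 7 ≤ Fintype.card V)
    (hG : ∀ a ∈ T, ∀ b ∈ T, a ≠ b → ¬ (a ∈ A ∧ b ∈ A) → G.Adj a b) :
    ∃ φ, IsCliqueMinus K3unionP3 G T φ := by
  obtain ⟨B, hBA, hB⟩ := Finset.exists_subset_card_eq (s := Aᶜ) (n := 4) (by
    rw [Finset.card_compl]; omega)
  have hdis : ∀ a ∈ A, ∀ b ∈ B, a ≠ b := fun a ha b hb h =>
    Finset.mem_compl.1 (hBA hb) (h ▸ ha)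
  let f := (A.equivFinOfCardEq hA).symm
  let g := (B.equivFinOfCardEq hB).symm
  let p : Fin 3 ⊕ Fin 4 ↪ V := ⟨Sum.elim (fun i => (f i).1) fun i => (g i).1,
    (Subtype.val_injective.comp f.injective).sumElim
      (Subtype.val_injective.comp g.injective) fun i j => hdis _ (f i).2 _ (g j).2⟩
  refine exists_isCliqueMinus_of_embedding (E := cliqueWithout A ⊥) p (fun a b h => ?_)
    (fun a ha b hb hab h => hG a ha b hb hab fun hc => h ⟨hab, hc.1, hc.2, fun h => h⟩)
  obtain ⟨hab, ha, hb, -⟩ := h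
  refine ⟨.inl (f.symm ⟨a, ha⟩), .inl (f.symm ⟨b, hb⟩), ?_, ?_, ?_⟩
  · simp [p]
  · simp [p]
  · simp [K3unionP3, hab]

theorem exists_equiv_antitone {n : ℕ} (hn : n = Fintype.card V) (d : V → ℕ) :
    ∃ e : Fin n ≃ V, Antitone fun i => d (e i) := by
  subst hn
  let e₀ := (Fintype.equivFin V).symm
  let σ := Tuple.sort fun i => OrderDual.toDual (d (e₀ i))
  refine ⟨σ.trans e₀, fun i j hij => ?_⟩
  exact Tuple.monotone_sort (fun i => OrderDual.toDual (d (e₀ i))) hij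

/-- Every graph of large degree sum has the same degrees as a graph with a clique on `r + 1`
vertices minus part of a copy of `K3 ∪ P3`. -/
theorem exists_isCliqueMinus (r : ℕ) (hr : 2 ≤ r) : ∀ (V : Type) [Fintype V] (G : SimpleGraph V),
    5 * r + 18 ≤ Fintype.card V → r + 42 ≤ Fintype.card V →
    (2 * (r : ℤ) - 5) * Fintype.card V - r ^ 2 + 4 * r ≤ (∑ v, vdeg G v : ℕ) + 1 →
    ∃ (G' : SimpleGraph V) (T : Finset V) (φ : V → Option (Fin 3 ⊕ Fin 4)),
      (∀ v, vdeg G' v = vdeg G v) ∧ T.card = r + 1 ∧ IsCliqueMinus K3unionP3 G' T φ := by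
  induction r, hr using Nat.le_induction with
  | base =>
    intro V _ G hn _ _
    obtain ⟨A, -, hA⟩ := Finset.exists_subset_card_eq (s := (Finset.univ : Finset V)) (n := 3)
      (by rw [Finset.card_univ]; omega)
    obtain ⟨φ, hφ⟩ := exists_isCliqueMinus_of_triple (G := G) (T := A) hA (by omega)
      fun a ha b hb _ h => absurd ⟨ha, hb⟩ h
    exact ⟨G, A, φ, fun _ => rfl, hA, hφ⟩
  | succ r hr ih =>
    intro V _ G hn hn' hS
    obtain ⟨n, hcard⟩ : ∃ n, n = Fintype.card V := ⟨_, rfl⟩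
    obtain ⟨e, he⟩ := exists_equiv_antitone hcard fun v => vdeg G v
    rw [← hcard] at hn hn' hS
    set D : ℕ → ℕ := fun i => if h : i < n then vdeg G (e ⟨i, h⟩) else 0 with hDdef
    have hDe : ∀ i : Fin n, D i = vdeg G (e i) := fun i => by simp [hDdef]
    have hD : Antitone D := by
      intro i j hij
      simp only [hDdef]
      split_ifs with h1 h2
      · exact he (show (⟨i, h2⟩ : Fin n) ≤ ⟨j, h1⟩ from hij)
      · omega
      · exact Nat.zero_le _
      · exact le_rfl
    have hDv : ∀ v, vdeg G v = D (e.symm v) := fun v => by rw [hDe]; simp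
    have hsum : ∑ v, vdeg G v = ∑ i ∈ Finset.range n, D i := by
      rw [← Fin.sum_univ_eq_sum_range, ← Equiv.sum_comp e]
      exact Finset.sum_congr rfl fun i _ => (hDe i).symm
    have hn0 : 0 < n := by omega
    -- A vertex with three neighbours already settles this case: only edges of the triangle on those
    -- neighbours can be missing.
    by_cases hstar : r + 1 = 3 ∧ 3 ≤ D 0
    · obtain ⟨A, hAN, hA⟩ := Finset.exists_subset_card_eq
        (s := Finset.univ.filter fun w => G.Adj (e ⟨0, hn0⟩) w) (n := 3) (by
          have := hDe ⟨0, hn0⟩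
          rw [vdeg] at this
          rw [← this]
          exact hstar.2)
      have hadj : ∀ a ∈ A, G.Adj (e ⟨0, hn0⟩) a := fun a ha => (Finset.mem_filter.1 (hAN ha)).2
      have huA : e ⟨0, hn0⟩ ∉ A := fun h => G.loopless.irrefl _ (hadj _ h)
      obtain ⟨φ, hφ⟩ := exists_isCliqueMinus_of_triple (G := G)
        (T := insert (e ⟨0, hn0⟩) A) hA (by omega) (fun a ha b hb hab h => by
          rcases Finset.mem_insert.1 ha with rfl | ha <;>
            rcases Finset.mem_insert.1 hb with rfl | hb
          · exact absurd rfl hab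
          · exact hadj _ hb
          · exact (hadj _ ha).symm
          · exact absurd ⟨ha, hb⟩ h)
      exact ⟨G, _, φ, fun _ => rfl, by rw [Finset.card_insert_of_notMem huA, hA, hstar.1], hφ⟩
    by_cases hflat : D 0 + 1 < n ∧ D (r + 1) ≤ D (D 0 + 1)
    · have hGe : ∀ i : Fin n, vdeg (G.comap e) i = D i := fun i => by
        rw [vdeg_map_equiv, hDe]
      have hF : FlatSequence n (r + 1) D fun k => (∑ i ∈ Finset.range k, D i : ℕ) :=
        { three_le := by omega
          le_n := hn
          le_n' := hn'
          anti := hD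
          even := by rw [← hsum]; exact even_sum_vdeg G
          P_eq := fun _ => rfl
          erdosGallai := fun k hk => by
            have h := two_mul_sum_range_le hGe hk
            rcases k with _ | k
            · simp
              positivity
            · rw [Nat.add_sub_cancel] at h
              zify at h ⊢
              linarith
          le_P := by rw [hsum] at hS; exact hS
          flat := hflat.2
          lt_n := hflat.1
          four_le_or := by omega }
      obtain ⟨G', T, φ, hG', hT, hφ⟩ := hF.hasNearClique
      refine ⟨G'.comap e.symm, T.map e.symm.symm.toEmbedding, _, fun v => ?_, ?_,
        hφ.comap_equiv e.symm⟩
      · rw [vdeg_map_equiv, hG', ← hDv]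
      · rw [Finset.card_map, hT]
    · set u := e ⟨0, hn0⟩ with hu
      have hDu : vdeg G u = D 0 := (hDe ⟨0, hn0⟩).symm
      have hDlt : D 0 < n := by rw [← hDu, hcard]; exact vdeg_lt_card G u
      set H := Finset.univ.filter fun v => D (r + 1) ≤ vdeg G v with hH
      -- Failure of flatness is used only here: `u` then has enough edges to reach every other
      -- vertex of degree at least D (r + 1).
      have hHle : H.card ≤ D 0 + 1 := by
        by_cases h : D 0 + 1 < n
        · have hsub : H ⊆ (Finset.univ.filter fun i : Fin n => i.val < D 0 + 1).map
              e.toEmbedding := by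
            intro v hv
            have hv := (Finset.mem_filter.1 hv).2
            refine Finset.mem_map.2 ⟨e.symm v, ?_, by simp⟩
            rw [Finset.mem_filter]
            refine ⟨Finset.mem_univ _, ?_⟩
            by_contra hge
            have := hD (not_lt.1 hge)
            rw [← hDv] at this
            exact hflat ⟨h, hv.trans this⟩
          have := Finset.card_le_card hsub
          rw [Finset.card_map, card_filter_val_lt h.le] at this
          exact this
        · have := Finset.card_le_univ H
          omega
      have hHge : r + 2 ≤ H.card := by
        have hsub : (Finset.univ.filter fun i : Fin n => i.val < r + 2).map e.toEmbedding ⊆ H := by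
          intro v hv
          obtain ⟨i, hi, rfl⟩ := Finset.mem_map.1 hv
          have hi := (Finset.mem_filter.1 hi).2
          rw [hH, Finset.mem_filter]
          refine ⟨Finset.mem_univ _, ?_⟩
          rw [Equiv.coe_toEmbedding, ← hDe]
          exact hD (by omega)
        have := Finset.card_le_card hsub
        rwa [Finset.card_map, card_filter_val_lt (by omega)] at this
      have huH : u ∈ H := by
        rw [hH, Finset.mem_filter, hDu]
        exact ⟨Finset.mem_univ _, hD (Nat.zero_le _)⟩
      have hX : ∀ v, v ≠ u → (v ∈ H.erase u ↔ D (r + 1) ≤ vdeg G v) := fun v hv => by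
        simp [hH, hv]
      obtain ⟨G₁, hG₁, hadj⟩ := exists_adj_top G u (H.erase u) (Finset.notMem_erase _ _)
        (by rw [Finset.card_erase_of_mem huH, hDu]; omega) (fun x hx y hy hyu => by
          rw [hX x (Finset.ne_of_mem_erase hx)] at hx
          rw [hX y hyu] at hy
          omega)
      have hcW : Fintype.card {v // v ≠ u} + 1 = n := by
        rw [Fintype.card_subtype_compl, Fintype.card_subtype_eq, ← hcard]
        omega
      have hs₁ := sum_vdeg_eq_comap_val G₁ u
      rw [Finset.sum_congr rfl fun v _ => hG₁ v, hG₁ u, hDu] at hs₁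
      -- Deleting `u` costs 2 D 0 ≤ 2(n - 1), exactly the difference of the two thresholds.
      obtain ⟨G₂, T₂, φ₂, hG₂, hT₂, hφ₂⟩ := ih {v // v ≠ u} (G₁.comap Subtype.val) (by omega) (by omega) (by
        have h1 : (Fintype.card {v // v ≠ u} : ℤ) = n - 1 := by omega
        rw [hs₁] at hS
        rw [h1]
        have h2 : (D 0 : ℤ) + 1 ≤ n := by omega
        push_cast at hS ⊢
        linarith)
      set X : Finset {v // v ≠ u} := Finset.univ.filter fun w => w.1 ∈ H.erase u with hXdef
      have hXcard : X.card = (H.erase u).card := by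
        rw [← Finset.card_map (Function.Embedding.subtype _)]
        congr 1
        ext v
        simp only [hXdef, Finset.mem_map, Finset.mem_filter, Finset.mem_univ, true_and,
          Function.Embedding.coe_subtype]
        exact ⟨by rintro ⟨w, hw, rfl⟩; exact hw,
          fun h => ⟨⟨v, Finset.ne_of_mem_erase h⟩, h, rfl⟩⟩
      -- After the deletion, vertices of `X` keep degree at least D (r + 1) - 1 and the others have
      -- at most that, so `X` is still on top.
      obtain ⟨G₃, T₃, φ₃, hG₃, hTX, hT₃, hφ₃⟩ := hφ₂.exists_subset (X := X) (by
          rw [hT₂, hXcard, Finset.card_erase_of_mem huH]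
          omega) (fun x hx z hz => by
        rw [hG₂, hG₂]
        have hx := (Finset.mem_filter.1 hx).2
        have hz : z.1 ∉ H.erase u := fun h => hz (Finset.mem_filter.2 ⟨Finset.mem_univ _, h⟩)
        have h1 := vdeg_eq_vdeg_comap_val G₁ u x
        have h2 := vdeg_eq_vdeg_comap_val G₁ u z
        rw [if_pos (hadj _ hx).symm, hG₁] at h1
        rw [hG₁] at h2
        rw [hX _ x.2] at hx
        rw [hX _ z.2] at hz
        omega)
      refine ⟨addVertex G₁ u G₃, insert u (T₃.map (Function.Embedding.subtype _)),
        fun v => if h : v ≠ u then φ₃ ⟨v, h⟩ else none, fun v => ?_, ?_, ?_, ?_⟩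
      · rw [vdeg_addVertex (fun w => by rw [hG₃, hG₂]), hG₁]
      · rw [Finset.card_insert_of_notMem, Finset.card_map, hT₃, hT₂]
        intro h
        obtain ⟨w, -, hw⟩ := Finset.mem_map.1 h
        exact w.2 hw
      · intro a ha b hb h1 h2
        have hau : a ≠ u := fun h => by simp [h] at h1
        have hbu : b ≠ u := fun h => by
          simp only [h, hau, ne_eq, not_true_eq_false, not_false_eq_true, dif_pos, dif_neg] at h1 h2
          exact h1 h2
        simp only [dif_pos hau, dif_pos hbu] at h1 h2
        have hmem : ∀ v (hv : v ≠ u), v ∈ insert u (T₃.map (Function.Embedding.subtype _)) →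
            (⟨v, hv⟩ : {v // v ≠ u}) ∈ T₃ := by
          intro v hv h
          obtain ⟨w, hw, rfl⟩ := Finset.mem_map.1 ((Finset.mem_insert.1 h).resolve_left hv)
          exact hw
        exact congrArg Subtype.val (hφ₃.1 _ (hmem a hau ha) _ (hmem b hbu hb) h1 h2)
      · intro a ha b hb hab h'
        rcases Finset.mem_insert.1 ha with rfl | ha <;> rcases Finset.mem_insert.1 hb with hb | hb
        · exact absurd hb.symm hab
        · obtain ⟨w, hw, rfl⟩ := Finset.mem_map.1 hb
          refine absurd (addVertex_adj.2 (hadj w.1 ?_).symm).symm h'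
          exact (Finset.mem_filter.1 (hTX hw)).2
        · subst hb
          obtain ⟨w, hw, rfl⟩ := Finset.mem_map.1 ha
          refine absurd (addVertex_adj.2 (hadj w.1 ?_).symm) h'
          exact (Finset.mem_filter.1 (hTX hw)).2
        · obtain ⟨w, hw, rfl⟩ := Finset.mem_map.1 ha
          obtain ⟨x, hx, rfl⟩ := Finset.mem_map.1 hb
          have hne : w ≠ x := fun h => hab (h ▸ rfl)
          obtain ⟨i, j, hi, hj, hij⟩ := hφ₃.2 w hw x hx hne
            fun h => h' (addVertex_adj_val.2 h)
          refine ⟨i, j, ?_, ?_, hij⟩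
          · simpa [w.2] using hi
          · simpa [x.2] using hj

end Induction

/-! ### Why forbidding C_4 and Z_4 blocks the near-clique. -/

section Obstruction

theorem Z4_adj {a b : Fin 4} : Z4.Adj a b ↔ a ≠ b ∧ s(a, b) ≠ s(0, 1) ∧ s(a, b) ≠ s(1, 2) := by
  simp only [Z4, completeMinus, SimpleGraph.compl_adj, SimpleGraph.map_adj,
    SimpleGraph.pathGraph_adj, Fin.castLEEmb_apply]
  revert a b
  decide

theorem exists_embedding_of_ne {α : Type*} {a b c d : α} (h : [a, b, c, d].Nodup) :
    ∃ e : Fin 4 ↪ α, e 0 = a ∧ e 1 = b ∧ e 2 = c ∧ e 3 = d :=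
  ⟨⟨[a, b, c, d].get, List.nodup_iff_injective_get.1 h⟩, rfl, rfl, rfl, rfl⟩

/-- A graph on four vertices with at most one vertex of degree larger than one, of degree two,
avoids a 4-cycle or a triangle with a pendant edge. -/
theorem cycleGraph_isContained_compl_or {H : SimpleGraph (Fin 4)} (p : Fin 4)
    (h₁ : ∀ a b c, H.Adj a b → H.Adj a c → b = c ∨ a = p)
    (h₂ : ∀ a b c d, H.Adj a b → H.Adj a c → H.Adj a d → ¬ [b, c, d].Nodup) :
    SimpleGraph.cycleGraph 4 ⊑ Hᶜ ∨ Z4 ⊑ Hᶜ := by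
  have hfour : ∀ a b c : Fin 4, a ≠ b → a ≠ c → b ≠ c → ∃ d, [a, b, c, d].Nodup := by decide
  by_cases hpath : ∃ a b c, H.Adj a b ∧ H.Adj a c ∧ b ≠ c
  · right
    obtain ⟨a, b, c, hab, hac, hbc⟩ := hpath
    obtain ⟨d, hd⟩ := hfour a b c hab.ne hac.ne hbc
    -- `H` is exactly the path b, a, c with `d` isolated, so its complement is Z_4.
    obtain ⟨e, h0, h1, h2, h3⟩ := exists_embedding_of_ne (a := b) (b := a) (c := c) (d := d) (by
      simp at hd ⊢; tauto)
    simp only [List.nodup_cons, List.mem_cons, not_or, List.not_mem_nil, not_false_eq_true,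
      List.nodup_nil, and_true] at hd
    have hap := (h₁ a b c hab hac).resolve_left hbc
    have key : ∀ x y z, x ≠ a → H.Adj x y → H.Adj x z → y = z := fun x y z hx hy hz =>
      (h₁ x y z hy hz).resolve_right (hap ▸ hx)
    have hbc' : ¬ H.Adj b c := fun h => hac.ne (key b a c hab.ne' hab.symm h)
    have hbd : ¬ H.Adj b d := fun h => hd.1.2.2 (key b a d hab.ne' hab.symm h)
    have hcd : ¬ H.Adj c d := fun h => hd.1.2.2 (key c a d hac.ne' hac.symm h)
    have had : ¬ H.Adj a d := fun h => h₂ a b c d hab hac h (by simp; tauto)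
    refine ⟨⟨⟨e, fun {i j} hij => ?_⟩, e.injective⟩⟩
    refine (SimpleGraph.compl_adj _ _ _).2 ⟨e.injective.ne hij.ne, ?_⟩
    have hc : ∀ i j : Fin 4, i ≠ j ∧ s(i, j) ≠ s(0, 1) ∧ s(i, j) ≠ s(1, 2) →
        (i = 0 ∨ i = 2) ∧ j = 3 ∨ (j = 0 ∨ j = 2) ∧ i = 3 ∨ i = 1 ∧ j = 3 ∨ j = 1 ∧ i = 3 ∨
          i = 0 ∧ j = 2 ∨ j = 0 ∧ i = 2 := by decide
    obtain ⟨rfl | rfl, rfl⟩ | ⟨rfl | rfl, rfl⟩ | ⟨rfl, rfl⟩ | ⟨rfl, rfl⟩ | ⟨rfl, rfl⟩ | ⟨rfl, rfl⟩ :=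
      hc i j (Z4_adj.1 hij) <;>
        simp only [h0, h1, h2, h3] <;> first | assumption | exact fun h => absurd h.symm ‹_›
  · left
    push Not at hpath
    -- Here `H` is a matching; taking its edges as diagonals leaves the cycle a, b, c, d in the
    -- complement.
    obtain ⟨a, b, c, d, hd, hac⟩ : ∃ a b c d, [a, b, c, d].Nodup ∧ (H.Adj a c ∨ H = ⊥) := by
      by_cases h : H = ⊥
      · exact ⟨0, 1, 2, 3, by decide, Or.inr h⟩
      · obtain ⟨a, c, hac⟩ := SimpleGraph.ne_bot_iff_exists_adj.1 h
        obtain ⟨b, d, hbd⟩ : ∃ b d, [a, b, c, d].Nodup := by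
          have : ∀ a c : Fin 4, a ≠ c → ∃ b d, [a, b, c, d].Nodup := by decide
          exact this a c hac.ne
        exact ⟨a, b, c, d, hbd, Or.inl hac⟩
    obtain ⟨e, h0, h1, h2, h3⟩ := exists_embedding_of_ne hd
    simp only [List.nodup_cons, List.mem_cons, not_or, List.not_mem_nil, not_false_eq_true,
      List.nodup_nil, and_true] at hd
    have hne : ∀ x, (x = b ∨ x = d) → ¬ H.Adj a x ∧ ¬ H.Adj c x := fun x hx => by
      rcases hac with hac | rfl
      · refine ⟨fun h => ?_, fun h => ?_⟩
        · have := hpath a c x hac h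
          rcases hx with rfl | rfl <;> tauto
        · have := hpath c a x hac.symm h
          rcases hx with rfl | rfl <;> tauto
      · simp
    obtain ⟨hab, hcb⟩ := hne b (Or.inl rfl)
    obtain ⟨had, hcd⟩ := hne d (Or.inr rfl)
    refine ⟨⟨⟨e, fun {i j} hij => ?_⟩, e.injective⟩⟩
    refine (SimpleGraph.compl_adj _ _ _).2 ⟨e.injective.ne hij.ne, ?_⟩
    have hc : ∀ i j : Fin 4, i - j = 1 ∨ j - i = 1 →
        (i = 0 ∨ i = 2) ∧ (j = 1 ∨ j = 3) ∨ (i = 1 ∨ i = 3) ∧ (j = 0 ∨ j = 2) := by decide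
    obtain ⟨rfl | rfl, rfl | rfl⟩ | ⟨rfl | rfl, rfl | rfl⟩ :=
      hc i j (SimpleGraph.cycleGraph_adj.1 hij) <;>
        simp only [h0, h1, h2, h3] <;> first | assumption | exact fun h => absurd h.symm ‹_›

/-- Vertices outside the range of `f` are isolated in `U.map f`, so a graph without isolated
vertices cannot use them. -/
theorem isContained_of_isContained_map {L V W : Type*} {H : SimpleGraph L} {U : SimpleGraph V}
    {f : V ↪ W} (hH : ∀ v, ∃ w, H.Adj v w) (h : H ⊑ U.map f) : H ⊑ U := by
  obtain ⟨φ⟩ := h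
  have : ∀ v, ∃ x, f x = φ v := fun v => by
    obtain ⟨w, hw⟩ := hH v
    obtain ⟨x, -, -, hx, -⟩ := (SimpleGraph.map_adj _ _ _ _).1 (φ.toHom.map_adj hw)
    exact ⟨x, hx⟩
  choose g hg using this
  refine ⟨⟨⟨g, fun {a b} hab => ?_⟩, fun a b hab => φ.injective ?_⟩⟩
  · have := φ.toHom.map_adj hab
    rw [SimpleGraph.Copy.coe_toHom, ← hg, ← hg, SimpleGraph.map_adj_apply] at this
    exact this
  · rw [SimpleGraph.Copy.coe_toHom, ← hg, ← hg]
    exact congrArg f hab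

-- Each vertex outside `A` is joined to all of `A`, so outside `A` the graph has degrees at most 1,
-- or 2 at `p`. At least four vertices of a copy land there, and each pair not adjacent in `G` must
-- come from an edge of `U`.
open scoped Classical in
theorem not_completeMinus_isContained {V K L : Type*} [Fintype V] [Fintype L] {G : SimpleGraph V}
    {A : Finset V} (p : V) {U : SimpleGraph K} {f : K ↪ L}
    (hA : ∀ v ∈ A, vdeg G v + 1 = Fintype.card V)
    (hG : ∀ v ∉ A, vdeg G v ≤ A.card + if v = p then 2 else 1)
    (hL : A.card + 4 ≤ Fintype.card L)
    (hC4 : ¬ SimpleGraph.cycleGraph 4 ⊑ U) (hZ4 : ¬ Z4 ⊑ U) : ¬ completeMinus U f ⊑ G := by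
  rintro ⟨φ⟩
  have huniv : ∀ v ∈ A, ∀ w, w ≠ v → G.Adj v w := fun v hv w hw => by
    by_contra h
    have hs : (Finset.univ.filter fun w => G.Adj v w) ⊆ (Finset.univ.erase v).erase w :=
      fun x hx => by
        have hx := (Finset.mem_filter.1 hx).2
        exact Finset.mem_erase.2 ⟨fun hxw => h (hxw ▸ hx),
          Finset.mem_erase.2 ⟨hx.ne', Finset.mem_univ _⟩⟩
    have hc := Finset.card_le_card hs
    rw [Finset.card_erase_of_mem (Finset.mem_erase.2 ⟨hw, Finset.mem_univ _⟩),
      Finset.card_erase_of_mem (Finset.mem_univ _), Finset.card_univ] at hc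
    have := hA v hv
    have := Fintype.one_lt_card_iff.2 ⟨v, w, hw.symm⟩
    rw [vdeg] at *
    omega
  have hout : ∀ v ∉ A, ∀ B : Finset V, Disjoint A B → (∀ w ∈ B, G.Adj v w) →
      B.card ≤ if v = p then 2 else 1 := fun v hv B hAB hB => by
    have hs : A ∪ B ⊆ Finset.univ.filter fun w => G.Adj v w := fun w hw => by
      refine Finset.mem_filter.2 ⟨Finset.mem_univ _, ?_⟩
      rcases Finset.mem_union.1 hw with h | h
      · exact (huniv w h v fun hvw => hv (hvw ▸ h)).symm
      · exact hB w h
    have hc := Finset.card_le_card hs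
    rw [Finset.card_union_of_disjoint hAB] at hc
    have := hG v hv
    rw [vdeg] at this
    omega
  obtain ⟨Q, hQ, hQ4⟩ := Finset.exists_subset_card_eq
    (s := Finset.univ.filter fun x => φ x ∉ A) (n := 4) (by
      have h1 : (Finset.univ.filter fun x => φ x ∈ A).card ≤ A.card :=
        Finset.card_le_card_of_injOn φ (fun x hx => by simpa using hx) φ.injective.injOn
      have h2 := Finset.card_filter_add_card_filter_not (s := Finset.univ) fun x => φ x ∈ A
      rw [Finset.card_univ] at h2
      omega)
  let g : Fin 4 ↪ L := (Q.equivFinOfCardEq hQ4).symm.toEmbedding.trans (.subtype _)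
  have hg : ∀ i, φ (g i) ∉ A := fun i =>
    (Finset.mem_filter.1 (hQ ((Q.equivFinOfCardEq hQ4).symm i).2)).2
  have hinj : Function.Injective fun i => φ (g i) := φ.injective.comp g.injective
  let H := G.comap fun i => φ (g i)
  have hHU : Hᶜ ⊑ U.map f := by
    refine ⟨⟨⟨g, fun {i j} hij => ?_⟩, g.injective⟩⟩
    rw [SimpleGraph.compl_adj] at hij
    by_contra h
    exact hij.2 (φ.toHom.map_adj ((SimpleGraph.compl_adj _ _ _).2 ⟨g.injective.ne hij.1, h⟩))
  obtain ⟨q, hq⟩ : ∃ q, ∀ i, φ (g i) = p → i = q := by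
    by_cases h : ∃ q, φ (g q) = p
    · obtain ⟨q, hq⟩ := h
      exact ⟨q, fun i hi => hinj (hi.trans hq.symm)⟩
    · push Not at h
      exact ⟨0, fun i hi => absurd hi (h i)⟩
  have hdis : ∀ B : Finset (Fin 4), Disjoint A (B.map ⟨_, hinj⟩) := fun B => by
    rw [Finset.disjoint_right]
    intro v hv
    obtain ⟨i, -, rfl⟩ := Finset.mem_map.1 hv
    exact hg i
  have hdeg : ∀ i, ∀ B : Finset (Fin 4), (∀ j ∈ B, H.Adj i j) →
      B.card ≤ if φ (g i) = p then 2 else 1 := fun i B hB => by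
    have := hout _ (hg i) (B.map ⟨_, hinj⟩) (hdis B) fun w hw => by
      obtain ⟨j, hj, rfl⟩ := Finset.mem_map.1 hw
      exact hB j hj
    rwa [Finset.card_map] at this
  have := cycleGraph_isContained_compl_or (H := H) q (fun a b c hab hac => by
    by_contra! h
    have := hdeg a {b, c} (by simp [hab, hac])
    rw [Finset.card_pair h.1, if_neg fun hp => h.2 (hq a hp)] at this
    omega) (fun a b c d hab hac had hn => by
    have := hdeg a [b, c, d].toFinset (by simp [hab, hac, had])
    rw [List.toFinset_card_of_nodup hn] at this
    simp only [List.length_cons, List.length_nil] at this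
    split_ifs at this <;> omega)
  rcases this with h | h
  · refine hC4 (isContained_of_isContained_map (f := f) ?_ (h.trans hHU))
    simp only [SimpleGraph.cycleGraph_adj]
    decide
  · refine hZ4 (isContained_of_isContained_map (f := f) ?_ (h.trans hHU))
    simp only [Z4_adj]
    decide

end Obstruction

/-! ### The extremal graph. -/

section Extremal

variable {V : Type*} [Fintype V] [DecidableEq V]

theorem exists_vdeg_eq_universal (A : Finset V) {p : V} (hp : p ∉ A) {q : ℕ} (hq : 0 < q)
    (hq' : q ≤ 2) (hA : 3 ≤ Aᶜ.card) (he : Even (Aᶜ.card - 1 + q)) :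
    ∃ G : SimpleGraph V, (∀ v ∈ A, vdeg G v = Fintype.card V - 1) ∧
      ∀ v ∉ A, vdeg G v = A.card + if v = p then q else 1 := by
  set b : V → ℕ := fun v => if v ∈ A then 0 else if v = p then q else 1 with hb
  have hbp : ∀ v ∈ Aᶜ.erase p, b v = 1 := fun v hv => by
    obtain ⟨h1, h2⟩ := Finset.mem_erase.1 hv
    rw [hb]
    simp only [if_neg (Finset.mem_compl.1 h2), if_neg h1]
  have hsum : ∑ v, b v = Aᶜ.card - 1 + q := by
    rw [← Finset.sum_add_sum_compl A, Finset.sum_eq_zero fun v hv => by simp [hb, hv], zero_add,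
      ← Finset.sum_erase_add _ _ (Finset.mem_compl.2 hp), Finset.sum_congr rfl hbp]
    simp [hb, hp]
  obtain ⟨B, hB⟩ := exists_vdeg_eq_of_almost_flat b 2
    (fun v => by simp only [hb]; split_ifs <;> omega)
    (hA.trans (Finset.card_le_card fun v hv => by
      rw [Finset.mem_compl] at hv
      simp only [hb, Finset.mem_filter, Finset.mem_univ, true_and, if_neg hv]
      split_ifs <;> omega)) (hsum ▸ he)
  let J : SimpleGraph V := (cliqueWithout Aᶜ ⊥)ᶜ
  have hJ : ∀ v w, J.Adj v w ↔ v ≠ w ∧ (v ∈ A ∨ w ∈ A) := fun v w => by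
    simp only [J, SimpleGraph.compl_adj, cliqueWithout, Finset.mem_compl, SimpleGraph.bot_adj]
    tauto
  have hBA : ∀ v ∈ A, ∀ w, ¬ B.Adj v w := fun v hv => vdeg_eq_zero.1 (by rw [hB]; simp [hb, hv])
  have hd : ∀ v, vdeg (J ⊔ B) v = vdeg J v + b v := fun v => by
    rw [vdeg_sup, hB]
    intro w h h'
    rcases ((hJ v w).1 h).2 with h | h
    · exact hBA v h w h'
    · exact hBA w h v h'.symm
  refine ⟨J ⊔ B, fun v hv => ?_, fun v hv => ?_⟩
  · rw [hd, vdeg, ← Finset.card_univ, ← Finset.card_erase_of_mem (Finset.mem_univ v)]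
    have : b v = 0 := by simp [hb, hv]
    rw [this, add_zero]
    congr 1
    ext w
    simp [hJ, hv, eq_comm]
  · rw [hd, vdeg]
    congr 1
    · congr 1
      ext w
      simp only [hJ, hv, false_or, Finset.mem_filter, Finset.mem_univ, true_and]
      exact ⟨fun h => h.2, fun h => ⟨fun h' => hv (h' ▸ h), h⟩⟩
    · simp [hb, hv]

end Extremal

/-! ### The value of σ. -/

section Sigma

theorem isRealization_iff {n : ℕ} {G : SimpleGraph (Fin n)} {d : Fin n → ℕ} :
    IsRealization G d ↔ ∀ i, vdeg G i = d i := by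
  simp only [IsRealization, ncard_neighborSet_eq_vdeg]

/-- The sequence of `m` terms `n - 1`, one term `m + q` and otherwise terms `m + 1` is graphic,
but not potentially `K_{r+1} - U`-graphic. -/
theorem exists_isGraphic_not_potentiallyGraphic {n m q : ℕ} {K L : Type*} [Fintype L]
    {U : SimpleGraph K} {f : K ↪ L} (hn : m + 3 ≤ n) (hq : 0 < q) (hq' : q ≤ 2)
    (he : Even (n - m - 1 + q)) (hL : m + 4 ≤ Fintype.card L)
    (hC4 : ¬ SimpleGraph.cycleGraph 4 ⊑ U) (hZ4 : ¬ Z4 ⊑ U) :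
    ∃ d : Fin n → ℕ, IsGraphic d ∧ ¬ PotentiallyGraphic (completeMinus U f) d ∧
      ∑ i, d i = m * (n - 1) + ((n - m) * (m + 1) + (q - 1)) := by
  classical
  set A : Finset (Fin n) := Finset.univ.filter fun i => i.val < m with hA
  have hAm : A.card = m := card_filter_val_lt (by omega)
  have hAc : Aᶜ.card = n - m := by rw [Finset.card_compl, hAm, Fintype.card_fin]
  set p : Fin n := ⟨m, by omega⟩ with hp
  have hmem : ∀ i, i ∈ A ↔ i.val < m := fun i => by simp [hA]
  have hpA : p ∉ A := by simp [hmem, hp]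
  obtain ⟨G, h1, h2⟩ := exists_vdeg_eq_universal A hpA hq hq' (by omega) (by rwa [hAc])
  rw [Fintype.card_fin] at h1
  rw [hAm] at h2
  refine ⟨vdeg G, ⟨fun i j hij => ?_, G, isRealization_iff.2 fun _ => rfl⟩, ?_, ?_⟩
  · by_cases hi : i ∈ A
    · rw [h1 i hi]
      have := vdeg_lt_card G j
      rw [Fintype.card_fin] at this
      omega
    · have hj : j ∉ A := by rw [hmem] at hi ⊢; omega
      rw [h2 i hi, h2 j hj]
      have : j = p → i = p := fun h => by
        rw [hmem] at hi
        rw [h, hp] at hij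
        exact le_antisymm hij (not_lt.1 hi)
      split_ifs <;> omega
  · rintro ⟨G', hG', hc⟩
    rw [isRealization_iff] at hG'
    refine not_completeMinus_isContained (G := G') (A := A) p (fun v hv => ?_) (fun v hv => ?_)
      (by omega) hC4 hZ4 hc
    · rw [hG', h1 v hv, Fintype.card_fin]
      omega
    · rw [hG', h2 v hv, hAm]
      split_ifs <;> omega
  · rw [← Finset.sum_add_sum_compl A, Finset.sum_congr rfl h1,
      Finset.sum_congr rfl fun i hi => h2 i (Finset.mem_compl.1 hi), Finset.sum_const,
      Finset.sum_add_distrib, Finset.sum_const, hAm, hAc,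
      ← Finset.sum_erase_add _ _ (Finset.mem_compl.2 hpA),
      Finset.sum_congr (g := fun _ => 1) rfl fun i hi => if_neg (Finset.ne_of_mem_erase hi),
      Finset.sum_const, Finset.card_erase_of_mem (Finset.mem_compl.2 hpA), hAc, if_pos rfl]
    simp only [smul_eq_mul, mul_one, mul_add]
    omega

theorem IsCliqueMinus.completeMinus_isContained {L K W V : Type*} [Fintype W]
    {H : SimpleGraph L} {U : SimpleGraph K} {f : K ↪ W} {G : SimpleGraph V} {T : Finset V}
    {φ : V → Option L} (h : IsCliqueMinus H G T φ) (hU : H ⊑ U) (hT : T.card = Fintype.card W) :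
    completeMinus U f ⊑ G := by
  classical
  obtain ⟨g⟩ := hU
  have hinj : Function.Injective fun l => f (g l) := f.injective.comp g.injective
  by_cases hW : Nonempty W
  swap
  · have := not_nonempty_iff.1 hW
    exact ⟨⟨⟨isEmptyElim, fun {a} => isEmptyElim a⟩, fun a => isEmptyElim a⟩⟩
  let ψ : T → W := fun t => (φ t).elim (Classical.arbitrary W) fun l => f (g l)
  have hψ : ∀ t : T, ∀ l, φ t = some l → ψ t = f (g l) := fun t l hl => by simp [ψ, hl]
  -- The labelled vertices of `T` must go to their places in the copy of `U`; the others may be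
  -- matched arbitrarily.
  obtain ⟨e, he⟩ := Set.MapsTo.exists_equiv_extend_of_card_eq (α := T) (t := (Finset.univ : Finset W))
    (s := {t : T | φ t ≠ none}) (f := ψ) (by rw [Fintype.card_coe, hT, Finset.card_univ])
    (fun _ _ => Finset.mem_coe.2 (Finset.mem_univ _)) (by
      intro a ha b hb hab
      obtain ⟨i, hi⟩ := Option.ne_none_iff_exists'.1 ha
      obtain ⟨j, hj⟩ := Option.ne_none_iff_exists'.1 hb
      rw [hψ a i hi, hψ b j hj] at hab
      have := hinj hab
      subst this
      exact Subtype.ext (h.1 _ a.2 _ b.2 ha (hi.trans hj.symm)))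
  let e' : W → T := fun w => e.symm ⟨w, Finset.mem_univ w⟩
  have he' : ∀ w, (e (e' w) : W) = w := fun w => by simp [e']
  have hinj' : Function.Injective e' := fun a b hab => by rw [← he' a, hab, he']
  refine ⟨⟨⟨fun w => (e' w : V), fun {a b} hab => ?_⟩, Subtype.val_injective.comp hinj'⟩⟩
  rw [completeMinus, SimpleGraph.compl_adj] at hab
  by_contra hadj
  obtain ⟨i, j, hi, hj, hij⟩ := h.2 _ (e' a).2 _ (e' b).2
    (fun hc => hab.1 (hinj' (Subtype.ext hc))) hadj
  have ha := he (e' a) (by simp [hi])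
  have hb := he (e' b) (by simp [hj])
  rw [he', hψ _ i hi] at ha
  rw [he', hψ _ j hj] at hb
  refine hab.2 ?_
  rw [ha, hb, SimpleGraph.map_adj_apply]
  exact g.toHom.map_adj hij

end Sigma

theorem theorem1p2 (n r k j : ℕ) (hn : 5 * r + 18 ≤ n) (hkr : k ≤ r + 1) (hk : 7 ≤ k)
    (hj : 6 ≤ j) (U : SimpleGraph (Fin k)) (hUj : U.edgeSet.ncard = j)
    (hU : K3unionP3 ⊑ U) (hC4 : ¬ SimpleGraph.cycleGraph 4 ⊑ U) (hZ4 : ¬ Z4 ⊑ U)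
    (f : Fin k ↪ Fin (r + 1)) :
    IsLeast (sigmaSet (completeMinus U f) n) (sigma (completeMinus U f) n) ∧
      (sigma (completeMinus U f) n : ℤ) =
        if Odd ((n : ℤ) - r) then ((r : ℤ) - 1) * (2 * n - r) - 3 * (n - r) - 1
        else ((r : ℤ) - 1) * (2 * n - r) - 3 * (n - r) := by
  -- `m` counts the universal vertices of the extremal graph.
  obtain ⟨m, rfl⟩ : ∃ m, r = m + 3 := ⟨r - 3, by omega⟩
  obtain ⟨q, hq, hq', hqo⟩ : ∃ q, 0 < q ∧ q ≤ 2 ∧ (q = 1 ↔ Odd ((n : ℤ) - (m + 3 : ℕ))) := by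
    by_cases h : Odd ((n : ℤ) - (m + 3 : ℕ))
    · exact ⟨1, by omega, by omega, by simpa using h⟩
    · exact ⟨2, by omega, by omega, by simpa using h⟩
  have he : Even (n - m - 1 + q) := by
    rw [Int.odd_iff] at hqo
    rw [Nat.even_iff]
    omega
  obtain ⟨d, hd, hdU, hsum⟩ := exists_isGraphic_not_potentiallyGraphic (f := f) (m := m)
    (by omega) hq hq' he (by simp) hC4 hZ4
  obtain ⟨s, hs⟩ : ∃ s, s = ∑ i, d i := ⟨_, rfl⟩
  rw [← hs] at hsum
  have hval : (s : ℤ) + 2 = if Odd ((n : ℤ) - (m + 3 : ℕ))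
      then (((m + 3 : ℕ) : ℤ) - 1) * (2 * n - (m + 3 : ℕ)) - 3 * (n - (m + 3 : ℕ)) - 1
      else (((m + 3 : ℕ) : ℤ) - 1) * (2 * n - (m + 3 : ℕ)) - 3 * (n - (m + 3 : ℕ)) := by
    have h1 : ((n - 1 : ℕ) : ℤ) = n - 1 := by omega
    have h2 : ((n - m : ℕ) : ℤ) = n - m := by omega
    rw [hsum]
    split_ifs with h
    · obtain rfl : q = 1 := hqo.2 h
      push_cast [h1, h2]
      ring
    · obtain rfl : q = 2 := by
        have := mt hqo.1 h
        omega
      push_cast [h1, h2]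
      ring
  have hseven : Even s := by
    obtain ⟨-, G, hG⟩ := hd
    rw [isRealization_iff] at hG
    rw [hs, ← Finset.sum_congr rfl fun i _ => hG i]
    exact even_sum_vdeg G
  have hleast : IsLeast (sigmaSet (completeMinus U f) n) (s + 2) := by
    refine ⟨⟨hseven.add even_two, fun d' hd' hle => ?_⟩, fun l hl => ?_⟩
    · obtain ⟨-, G, hG⟩ := hd'
      rw [isRealization_iff] at hG
      -- As r ≥ 6, the bound n ≥ 5r + 18 already implies n ≥ r + 42.
      obtain ⟨G', T, φ, hG', hT, hφ⟩ := exists_isCliqueMinus (m + 3) (by omega) (Fin n) G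
        (by rw [Fintype.card_fin]; omega) (by rw [Fintype.card_fin]; omega) (by
          rw [Fintype.card_fin, Finset.sum_congr rfl fun i _ => hG i]
          have h : (s : ℤ) + 2 ≤ (∑ i, d' i : ℕ) := by exact_mod_cast hle
          rw [hval] at h
          push_cast at h ⊢
          split_ifs at h <;> linarith)
      exact ⟨G', isRealization_iff.2 fun i => (hG' i).trans (hG i),
        hφ.completeMinus_isContained hU (by rw [hT, Fintype.card_fin])⟩
    · by_contra hlt
      obtain ⟨a, ha⟩ := hl.1
      obtain ⟨b, hb⟩ := hseven
      have h : l ≤ s := by omega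
      exact hdU (hl.2 d hd (hs ▸ h))
  have hσ : sigma (completeMinus U f) n = s + 2 := hleast.csInf_eq
  rw [hσ]
  exact ⟨hleast, by rw [← hval]; push_cast; rfl⟩
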